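/- Let $\lambda>0$ and $0<\beta\le 1$, let $E_\beta(z)=\sum_{n\ge0}z^n/\Gamma(\beta n+1)$ be the Mittag-Leffler function, and let $\pi_{\lambda,\beta}=\sum_{k\ge0}\frac{\lambda^k}{k!}E_\beta^{(k)}(-\lambda)\,\delta_k$ be the fractional Poisson measure on $\mathbb R$. For $n\ge 0$ and $x\in\mathbb C$ let $$C_n^{\lambda,\beta}(x)=\frac{d^n}{dz^n}\,\frac{e^{x\log(1+z)}}{E_\beta(\lambda z)}\Big|_{z=0}$$ (generalized Appell polynomials). The test function space $(N)^1_{\pi_{\lambda,\beta}}$ consists of the functions $\varphi:\mathbb R\to\mathbb C$ of the form $\varphi=\sum_{n\ge0}\varphi_nC_n^{\lambda,\beta}$ with $\varphi_n\in\mathbb C$ and $\|\varphi\|_q^2:=\sum_{n\ge0}(n!)^2\,2^{nq}|\varphi_n|^2<\infty$ for all $q\in\mathbb N_0$; it carries the projective limit topology given by the norms $\|\cdot\|_q$. The space $\mathcal E^1_{\min}(\mathbb C)$ consists of the entire functions $u$ with $|u|_l:=\sup_{z\in\mathbb C}|u(z)|\exp(-2^{-l}|z|)<\infty$ for all $l\in\mathbb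 N_0$; it carries the projective limit topology given by the norms $|\cdot|_l$. The coefficients $\varphi_n$ of each $\varphi\in(N)^1_{\pi_{\lambda,\beta}}$ are uniquely determined, and $\varphi(z):=\sum_{n\ge0}\varphi_nC_n^{\lambda,\beta}(z)$, $z\in\mathbb C$, is an entire function that extends $\varphi$. For every $z\in\mathbb C$ the function $x\mapsto\varphi(x+z)$ is $\pi_{\lambda,\beta}$-integrable, and the convolution $$(C_{\pi_{\lambda,\beta}}\varphi)(z)=\int_{\mathbb R}\varphi(x+z)\,d\pi_{\lambda,\beta}(x)$$ is a linear homeomorphism of $(N)^1_{\pi_{\lambda,\beta}}$ onto $\mathcal E^1_{\min}(\mathbb C)$. Moreover $$(C_{\pi_{\lambda,\beta}}\varphi)(z)=\sum_{n\ge0}\varphi_n\,(z)_n,\qquad z\in\mathbb C,$$ where $(z)_n=z(z-1)\cdots(z-n+1)$ is the falling factorial, and the series converges absolutely. -/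

import Mathlib

noncomputable section

namespace FracPoisson



/-! ### The fractional Poisson measure and its generalized Appell polynomials -/

/-- The Mittag-Leffler function `E_β(z) = ∑ zⁿ / Γ(β n + 1)`. -/
def mittagLeffler (β : ℝ) (z : ℂ) : ℂ :=
  ∑' n : ℕ, z ^ n / (Real.Gamma (β * n + 1) : ℂ)

/-- The mass `π_{lam,β}({k}) = lam ^ k / k! * E_β^{(k)}(-lam)`. The derivative is a real number,
since the Taylor coefficients of `E_β` are real. -/
def mass (lam β : ℝ) (k : ℕ) : ℝ :=
  lam ^ k / k.factorial * (iteratedDeriv k (mittagLeffler β) (-lam : ℂ)).re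

/-- The fractional Poisson measure `π_{lam,β} = ∑ₖ π_{lam,β}({k}) δₖ`, as a measure on `ℝ`. -/
def measure (lam β : ℝ) : MeasureTheory.Measure ℝ :=
  MeasureTheory.Measure.sum fun k : ℕ =>
    ENNReal.ofReal (mass lam β k) • MeasureTheory.Measure.dirac (k : ℝ)

/-- The Wick exponential `e^{zx} / E_β(lam (e^z - 1))`; the denominator is the Laplace transform
of `π_{lam,β}` at `z`. -/
def wickExp (lam β : ℝ) (z x : ℂ) : ℂ :=
  Complex.exp (z * x) / mittagLeffler β (lam * (Complex.exp z - 1))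

/-- The generalized Appell polynomial `C_n^{lam,β}(x)`: the `n`-th derivative at `z = 0` of
`z ↦ e_π(log (1 + z); x)`. It is a polynomial in `x`, here evaluated at any complex `x`. -/
def appell (lam β : ℝ) (n : ℕ) (x : ℂ) : ℂ :=
  iteratedDeriv n (fun z : ℂ => wickExp lam β (Complex.log (1 + z)) x) 0

/-! ### The test function space -/

/-- `c` is a sequence of coefficients of the function `φ`: all the norms
`∑ (n!)² 2^{nq} |c_n|²`, `q = 0, 1, 2, …`, are finite, and `φ = ∑ c_n C_n`. -/
def IsExpansion (lam β : ℝ) (c : ℕ → ℂ) (φ : ℝ → ℂ) : Prop :=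
  (∀ q : ℕ, Summable fun n : ℕ => (n.factorial : ℝ) ^ 2 * 2 ^ (n * q) * ‖c n‖ ^ 2) ∧
    ∀ x : ℝ, HasSum (fun n : ℕ => c n * appell lam β n x) (φ x)

theorem IsExpansion.zero (lam β : ℝ) : IsExpansion lam β 0 0 :=
  ⟨fun q => by simp [summable_zero], fun x => by simp [hasSum_zero]⟩

theorem IsExpansion.add {lam β : ℝ} {c d : ℕ → ℂ} {φ ψ : ℝ → ℂ}
    (h : IsExpansion lam β c φ) (k : IsExpansion lam β d ψ) :
    IsExpansion lam β (c + d) (φ + ψ) := by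
  refine ⟨fun q => ?_, fun x => ?_⟩
  · refine Summable.of_nonneg_of_le (fun n => by positivity) (fun n => ?_)
      (((h.1 q).add (k.1 q)).mul_left 2)
    have h1 : ‖(c + d) n‖ ^ 2 ≤ 2 * (‖c n‖ ^ 2 + ‖d n‖ ^ 2) := by
      have h2 : ‖(c + d) n‖ ≤ ‖c n‖ + ‖d n‖ := norm_add_le _ _
      nlinarith [norm_nonneg ((c + d) n), sq_nonneg (‖c n‖ - ‖d n‖)]
    have h3 : (0 : ℝ) ≤ (n.factorial : ℝ) ^ 2 * 2 ^ (n * q) := by positivity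
    nlinarith [mul_le_mul_of_nonneg_left h1 h3]
  · simpa [add_mul] using (h.2 x).add (k.2 x)

theorem IsExpansion.smul {lam β : ℝ} {c : ℕ → ℂ} {φ : ℝ → ℂ} (a : ℂ)
    (h : IsExpansion lam β c φ) : IsExpansion lam β (a • c) (a • φ) := by
  refine ⟨fun q => ?_, fun x => ?_⟩
  · refine ((h.1 q).mul_left (‖a‖ ^ 2)).congr fun n => ?_
    simp only [Pi.smul_apply, smul_eq_mul, norm_mul]
    ring
  · simpa [mul_assoc] using (h.2 x).mul_left a

/-- The functions `φ : ℝ → ℂ` that belong to the test function space. -/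
def testSubmodule (lam β : ℝ) : Submodule ℂ (ℝ → ℂ) where
  carrier := {φ | ∃ c, IsExpansion lam β c φ}
  zero_mem' := ⟨0, IsExpansion.zero lam β⟩
  add_mem' := fun ⟨c, hc⟩ ⟨d, hd⟩ => ⟨c + d, hc.add hd⟩
  smul_mem' := fun a _ ⟨c, hc⟩ => ⟨a • c, hc.smul a⟩

/-- The test function space `(N)¹` of the measure `π_{lam,β}`. It is a type of its own because it
does not carry the topology of pointwise convergence. -/
def TestSpace (lam β : ℝ) : Type := testSubmodule lam β

instance (lam β : ℝ) : AddCommGroup (TestSpace lam β) :=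
  inferInstanceAs (AddCommGroup (testSubmodule lam β))

instance (lam β : ℝ) : Module ℂ (TestSpace lam β) :=
  inferInstanceAs (Module ℂ (testSubmodule lam β))

namespace TestSpace

variable {lam β : ℝ}

/-- The underlying function `ℝ → ℂ`. -/
def toFun (φ : TestSpace lam β) : ℝ → ℂ := φ.1

/-- The coefficients `φ_n` in `φ = ∑ φ_n C_n`. -/
def coeff (φ : TestSpace lam β) : ℕ → ℂ := φ.2.choose

theorem isExpansion_coeff (φ : TestSpace lam β) : IsExpansion lam β φ.coeff φ.toFun :=
  φ.2.choose_spec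

theorem memℓp_weighted (q : ℕ) (φ : TestSpace lam β) :
    Memℓp (fun n : ℕ => (Real.sqrt ((n.factorial : ℝ) ^ 2 * 2 ^ (n * q)) : ℂ) * φ.coeff n) 2 := by
  refine memℓp_gen ((φ.isExpansion_coeff.1 q).congr fun n => ?_)
  have h : (0 : ℝ) ≤ (n.factorial : ℝ) ^ 2 * 2 ^ (n * q) := by positivity
  have e : (2 : ENNReal).toReal = ((2 : ℕ) : ℝ) := by norm_num
  rw [e, Real.rpow_natCast, norm_mul, mul_pow, Complex.norm_real, Real.norm_eq_abs, sq_abs,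
    Real.sq_sqrt h]

/-- The sequence `((n!)² 2^{nq})^{1/2} φ_n` in `ℓ²`. Its norm is the Hilbert norm
`‖φ‖_q = (∑ (n!)² 2^{nq} |φ_n|²)^{1/2}` of `φ`. -/
def toL2 (q : ℕ) (φ : TestSpace lam β) : lp (fun _ : ℕ => ℂ) 2 :=
  ⟨fun n : ℕ => (Real.sqrt ((n.factorial : ℝ) ^ 2 * 2 ^ (n * q)) : ℂ) * φ.coeff n, φ.memℓp_weighted q⟩

/-- The projective limit topology, defined by the Hilbert norms `‖φ‖_q`, `q = 0, 1, 2, …`. -/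
instance : TopologicalSpace (TestSpace lam β) :=
  ⨅ q : ℕ, TopologicalSpace.induced (toL2 q) inferInstance

/-- The extension of `φ` to the complex plane, `φ(z) = ∑ φ_n C_n(z)`. -/
def extend (φ : TestSpace lam β) (z : ℂ) : ℂ :=
  ∑' n : ℕ, φ.coeff n * appell lam β n z

/-- The convolution `(C_π φ)(z) = ∫ φ(x + z) dπ(x)`. -/
def conv (φ : TestSpace lam β) (z : ℂ) : ℂ :=
  ∫ x : ℝ, φ.extend (x + z) ∂(measure lam β)

end TestSpace

/-! ### Entire functions of order one and minimal type -/

/-- The entire functions `u` with `|u(z)| ≤ C exp(2^{-l} |z|)` for some `C`. -/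
def expSubmodule (l : ℕ) : Submodule ℂ (ℂ → ℂ) where
  carrier := {u | Differentiable ℂ u ∧ ∃ C : ℝ, ∀ z, ‖u z‖ ≤ C * Real.exp ((2 ^ l)⁻¹ * ‖z‖)}
  zero_mem' := ⟨differentiable_const 0, 0, fun z => by simp⟩
  add_mem' := fun {u v} ⟨hu, C, hC⟩ ⟨hv, D, hD⟩ =>
    ⟨hu.add hv, C + D, fun z => (norm_add_le _ _).trans (by linarith [hC z, hD z])⟩
  smul_mem' := fun a u ⟨hu, C, hC⟩ => ⟨hu.const_smul a, ‖a‖ * C, fun z => by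
    rw [Pi.smul_apply, norm_smul, mul_assoc]
    exact mul_le_mul_of_nonneg_left (hC z) (norm_nonneg a)⟩

/-- The space `ℰ¹_min(ℂ)` of entire functions of order one and minimal type. It is a type of its
own because it does not carry the topology of pointwise convergence. -/
def EMin : Type := (⨅ l : ℕ, expSubmodule l : Submodule ℂ (ℂ → ℂ))

instance : AddCommGroup EMin :=
  inferInstanceAs (AddCommGroup (⨅ l : ℕ, expSubmodule l : Submodule ℂ (ℂ → ℂ)))

instance : Module ℂ EMin :=
  inferInstanceAs (Module ℂ (⨅ l : ℕ, expSubmodule l : Submodule ℂ (ℂ → ℂ)))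

namespace EMin

/-- The underlying function `ℂ → ℂ`. -/
def toFun (u : EMin) : ℂ → ℂ := u.1

theorem bddAbove (l : ℕ) (u : EMin) :
    BddAbove (Set.range fun z : ℂ => ‖u.toFun z‖ * Real.exp (-((2 ^ l)⁻¹ * ‖z‖))) := by
  obtain ⟨-, C, hC⟩ := (Submodule.mem_iInf _).1 u.2 l
  refine ⟨C, ?_⟩
  rintro _ ⟨z, rfl⟩
  have h := mul_le_mul_of_nonneg_right (hC z) (Real.exp_pos (-((2 ^ l)⁻¹ * ‖z‖))).le
  rwa [mul_assoc, ← Real.exp_add, add_neg_cancel, Real.exp_zero, mul_one] at h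

/-- The norm `|u|_l = sup_z |u(z)| exp(-2^{-l} |z|)`. -/
def expNorm : SeminormFamily ℂ EMin ℕ := fun l =>
  Seminorm.of (fun u => ⨆ z : ℂ, ‖u.toFun z‖ * Real.exp (-((2 ^ l)⁻¹ * ‖z‖)))
    (fun u v => ciSup_le fun z => by
      refine le_trans ?_ (add_le_add (le_ciSup (bddAbove l u) z) (le_ciSup (bddAbove l v) z))
      rw [← add_mul]
      exact mul_le_mul_of_nonneg_right (norm_add_le _ _) (Real.exp_pos _).le)
    (fun a u => by
      rw [Real.mul_iSup_of_nonneg (norm_nonneg a)]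
      refine congrArg _ (funext fun z => ?_)
      rw [← mul_assoc, ← norm_mul]
      rfl)

/-- The projective limit topology, defined by the norms `|u|_l`, `l = 0, 1, 2, …`. -/
instance : TopologicalSpace EMin := expNorm.moduleFilterBasis.topology

end EMin

end FracPoisson

end

noncomputable section

namespace FracPoisson

open Filter Topology Finset

/-! ### Binomial coefficients with real or complex upper entry -/

/-! The Appell polynomials have the exponential generating function `(1 + w)^x / E_β(lam w)`, and
`π_{lam,β}` integrates `w^x` to `E_β(lam (w - 1))`. Shifting by `z` and integrating therefore leaves
`(1 + w)^z`: convolution sends `C_n` to the falling factorial `(z)_n` (`hasSum_mass_mul_appell`).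
Since `C_n` grows at most exponentially and `π_{lam,β}` has all exponential moments, sum and
integral may be interchanged (`integrable_and_integral_tsum_appell`), so convolution is the Newton
series map `c ↦ ∑ c_n (z)_n`. Values at `0, 1, 2, …` determine Newton coefficients by a triangular
system, which also gives uniqueness of the `φ_n`.

It remains to match rapid decay of the coefficients with minimal exponential type. In one direction,
`∑ |binom(z, n)| s^n ≤ (1 - s)^(-|z|)` with `s = 2^(-(l+1))` bounds the Newton series
(`norm_newton_le`). In the other, Cauchy's estimates bound the Taylor coefficients, and `z^m = ∑
S(m, n) (z)_n` with Stirling numbers of the second kind turns them into rapidly decreasing Newton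
coefficients (`weighted_newtonCoeff_le`). Both estimates are between explicit norms, so the
bijection is a homeomorphism.

The measure truncates negative weights to zero, so the masses must be shown nonnegative: this is
complete monotonicity of `x ↦ E_β(-x)` (`taylorCoeff_nonneg`). The proof is a discrete Laplace
inversion. The series `(1 - X)^(β-1) / ((1 - X)^β + μ)^(k+1)` has nonnegative coefficients for `0 ≤
μ < 1`; with `μ = lam n^(-β)`, its `n`-th coefficient times `n^(-βk)` tends to `E_β^{(k)}(-lam) /
k!`, because the `n`-th coefficient of `(1 - X)^(-1-a)` is asymptotic to `n^a / Γ(a+1)`. -/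

lemma succ_mul_choose_succ {K : Type*} [Field K] [CharZero K] (z : K) (n : ℕ) :
    ((n : K) + 1) * Ring.choose z (n + 1) = (z - n) * Ring.choose z n := by
  have h : (n.factorial : K) ≠ 0 := Nat.cast_ne_zero.2 n.factorial_ne_zero
  have h' : (n : K) + 1 ≠ 0 := Nat.cast_add_one_ne_zero n
  simp only [Ring.choose_eq_smul, smul_eq_mul, descPochhammer_succ_right, Polynomial.smeval_mul,
    Polynomial.smeval_sub, Polynomial.smeval_X, Polynomial.smeval_natCast, pow_one, pow_zero,
    Nat.factorial_succ, Nat.cast_mul, Nat.cast_succ, nsmul_eq_mul, mul_one]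
  field_simp

/-- The coefficient of `X ^ n` in `(1 - X) ^ s`. -/
def oneSubCoeff (s : ℝ) (n : ℕ) : ℝ := (-1) ^ n * Ring.choose s n

@[simp] lemma oneSubCoeff_zero (s : ℝ) : oneSubCoeff s 0 = 1 := by simp [oneSubCoeff]

lemma oneSubCoeff_succ (s : ℝ) (n : ℕ) :
    oneSubCoeff s (n + 1) = oneSubCoeff s n * ((n - s) / (n + 1)) := by
  have h' : (n : ℝ) + 1 ≠ 0 := Nat.cast_add_one_ne_zero n
  have h := succ_mul_choose_succ s n
  rw [oneSubCoeff, oneSubCoeff, pow_succ, mul_div_assoc', eq_div_iff h']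
  linear_combination (-1) ^ (n + 1) * h

lemma oneSubCoeff_add (s t : ℝ) (n : ℕ) :
    oneSubCoeff (s + t) n = ∑ p ∈ antidiagonal n, oneSubCoeff s p.1 * oneSubCoeff t p.2 := by
  rw [oneSubCoeff, Ring.add_choose_eq n (Commute.all s t), mul_sum]
  refine sum_congr rfl fun p hp => ?_
  rw [oneSubCoeff, oneSubCoeff, ← mem_antidiagonal.1 hp, pow_add]
  ring

lemma oneSubCoeff_nonneg {s : ℝ} (hs : s ≤ 0) (n : ℕ) : 0 ≤ oneSubCoeff s n := by
  induction n with
  | zero => simp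
  | succ n ih =>
    rw [oneSubCoeff_succ]
    exact mul_nonneg ih (div_nonneg (by have : (0 : ℝ) ≤ n := n.cast_nonneg; linarith)
      (by positivity))

lemma oneSubCoeff_nonpos {s : ℝ} (hs : 0 ≤ s) (hs1 : s ≤ 1) (n : ℕ) :
    oneSubCoeff s (n + 1) ≤ 0 := by
  induction n with
  | zero => simpa [oneSubCoeff_succ] using hs
  | succ n ih =>
    rw [oneSubCoeff_succ]
    refine mul_nonpos_of_nonpos_of_nonneg ih (div_nonneg ?_ (by positivity))
    have : (0 : ℝ) ≤ n := n.cast_nonneg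
    push_cast
    linarith

lemma oneSubCoeff_pos {a : ℝ} (ha : 0 ≤ a) (n : ℕ) : 0 < oneSubCoeff (-1 - a) n := by
  induction n with
  | zero => simp
  | succ n ih =>
    rw [oneSubCoeff_succ]
    exact mul_pos ih (div_pos (by have : (0 : ℝ) ≤ n := n.cast_nonneg; linarith) (by positivity))

lemma oneSubCoeff_le_pow {a : ℝ} (ha : 0 ≤ a) (n : ℕ) :
    oneSubCoeff (-1 - a) n ≤ (1 + a) ^ n := by
  induction n with
  | zero => simp
  | succ n ih =>
    rw [oneSubCoeff_succ, pow_succ]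
    have h : (0 : ℝ) ≤ n := n.cast_nonneg
    refine mul_le_mul ih ?_ (div_nonneg (by linarith) (by positivity)) (by positivity)
    rw [div_le_iff₀ (by positivity)]
    nlinarith

lemma oneSubCoeff_eq_prod (a : ℝ) (n : ℕ) :
    oneSubCoeff (-1 - a) n * n.factorial = ∏ j ∈ range n, (a + 1 + j) := by
  induction n with
  | zero => simp
  | succ n ih =>
    rw [oneSubCoeff_succ, prod_range_succ, ← ih, Nat.factorial_succ]
    have h' : (n : ℝ) + 1 ≠ 0 := Nat.cast_add_one_ne_zero n
    push_cast
    field_simp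
    ring

/-- Consecutive coefficients have ratio `1 + a/(n+1) ≤ exp(a/(n+1)) ≤ ((n+1)/n)^a`. This
monotonicity supplies the dominating function in the limit below, and the upper bounds on `1/Γ`. -/
lemma oneSubCoeff_div_rpow_anti {a : ℝ} (ha : 0 ≤ a) {m n : ℕ} (hm : 0 < m) (hmn : m ≤ n) :
    oneSubCoeff (-1 - a) n / (n : ℝ) ^ a ≤ oneSubCoeff (-1 - a) m / (m : ℝ) ^ a := by
  induction n, hmn using Nat.le_induction with
  | base => exact le_rfl
  | succ n hn ih =>
    refine le_trans ?_ ih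
    have hn0 : (0 : ℝ) < n := Nat.cast_pos.2 (hm.trans_le hn)
    rw [oneSubCoeff_succ, mul_div_assoc, mul_comm, div_eq_mul_inv (oneSubCoeff _ _),
      mul_comm (oneSubCoeff _ _)]
    refine mul_le_mul_of_nonneg_right ?_ (oneSubCoeff_pos ha n).le
    rw [inv_eq_one_div, div_le_div_iff₀ (by positivity) (by positivity), one_mul]
    have h1 : ((n : ℝ) - (-1 - a)) / (n + 1) ≤ (((n + 1 : ℕ) : ℝ) / n) ^ a := by
      have h2 : 1 / ((n : ℝ) + 1) ≤ Real.log (((n + 1 : ℕ) : ℝ) / n) := by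
        have := Real.one_sub_inv_le_log_of_pos (x := ((n + 1 : ℕ) : ℝ) / n) (by positivity)
        refine le_trans (le_of_eq ?_) this
        push_cast
        field_simp
        ring
      rw [Real.rpow_def_of_pos (by positivity)]
      calc ((n : ℝ) - (-1 - a)) / (n + 1) = 1 / ((n : ℝ) + 1) * a + 1 := by field_simp; ring
        _ ≤ Real.log (((n + 1 : ℕ) : ℝ) / n) * a + 1 := by gcongr
        _ ≤ _ := Real.add_one_le_exp _
    rw [Real.div_rpow (by positivity) hn0.le, le_div_iff₀ (by positivity)] at h1
    exact h1

/-- Euler's limit formula for `Γ(a+1)`, up to the factor `n / (n + a + 1) → 1`. -/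
lemma tendsto_oneSubCoeff_div_rpow {a : ℝ} (ha : 0 ≤ a) :
    Tendsto (fun n : ℕ => oneSubCoeff (-1 - a) n / (n : ℝ) ^ a) atTop
      (𝓝 (Real.Gamma (a + 1))⁻¹) := by
  have h1 := (Real.GammaSeq_tendsto_Gamma (a + 1)).inv₀ (Real.Gamma_pos_of_pos (by linarith)).ne'
  have h2 : Tendsto (fun n : ℕ => (n : ℝ) / (n + (a + 1))) atTop (𝓝 1) :=
    tendsto_natCast_div_add_atTop (a + 1)
  have h3 := h1.mul h2
  rw [mul_one] at h3
  refine h3.congr' ?_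
  filter_upwards [eventually_gt_atTop 0] with n hn
  have hn0 : (0 : ℝ) < n := Nat.cast_pos.2 hn
  have hf : (0 : ℝ) < n.factorial := Nat.cast_pos.2 n.factorial_pos
  rw [Real.GammaSeq, prod_range_succ, ← oneSubCoeff_eq_prod, Real.rpow_add hn0, Real.rpow_one]
  have : (0 : ℝ) < n ^ a := by positivity
  field_simp
  ring

/-! ### Complete monotonicity of the Mittag-Leffler function -/

/-- The coefficient of `X ^ n` in `(1 - X) ^ (β - 1) / ((1 - X) ^ β + μ) ^ (k + 1)`, expanded in
powers of `μ`. -/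
def resolventCoeff (β μ : ℝ) (k n : ℕ) : ℝ :=
  ∑' m : ℕ, (-μ) ^ m * ((m + k).choose k * oneSubCoeff (-1 - β * (m + k : ℕ)) n)

lemma summable_resolvent {β : ℝ} (hβ : 0 ≤ β) (hβ1 : β ≤ 1) {μ : ℝ} (hμ : |μ| < 1) (k n : ℕ) :
    Summable fun m : ℕ =>
      |μ| ^ m * ((m + k).choose k * oneSubCoeff (-1 - β * (m + k : ℕ)) n) := by
  -- The main bound shifts a summable series by `k + 1` and divides by `|μ|^(k+1)`, so `μ = 0` is
  -- separate.
  rcases eq_or_ne μ 0 with rfl | hμ0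
  · refine summable_of_ne_finset_zero (s := {0}) fun m hm => ?_
    simp at hm
    simp [hm]
  have hμ0 : 0 < |μ| := abs_pos.2 hμ0
  have h1 := summable_pow_mul_geometric_of_norm_lt_one (k + n) (r := |μ|) (by simpa using hμ)
  have h2 := ((summable_nat_add_iff (k + 1)).2 h1).mul_left ((|μ| ^ (k + 1))⁻¹)
  refine Summable.of_nonneg_of_le (fun m => ?_) (fun m => ?_) h2
  · have := (oneSubCoeff_pos (a := β * (m + k : ℕ)) (by positivity) n).le
    positivity
  · have h3 := oneSubCoeff_le_pow (a := β * (m + k : ℕ)) (by positivity) n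
    have h4 : ((m + k).choose k : ℝ) ≤ ((m + (k + 1) : ℕ) : ℝ) ^ k := by
      exact_mod_cast (Nat.choose_le_pow (m + k) k).trans (Nat.pow_le_pow_left (by omega) k)
    have h5 : (1 + β * (m + k : ℕ)) ^ n ≤ ((m + (k + 1) : ℕ) : ℝ) ^ n := by
      gcongr
      have : β * (m + k : ℕ) ≤ 1 * (m + k : ℕ) := by gcongr
      push_cast at *
      linarith
    calc |μ| ^ m * ((m + k).choose k * oneSubCoeff (-1 - β * (m + k : ℕ)) n)
        ≤ |μ| ^ m * (((m + (k + 1) : ℕ) : ℝ) ^ k * ((m + (k + 1) : ℕ) : ℝ) ^ n) := by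
          have := (oneSubCoeff_pos (a := β * (m + k : ℕ)) (by positivity) n).le
          gcongr
          exact h3.trans h5
      _ = _ := by
          rw [pow_add |μ| m, ← pow_add]
          field_simp

lemma summable_resolvent' {β : ℝ} (hβ : 0 ≤ β) (hβ1 : β ≤ 1) {μ : ℝ} (hμ : |μ| < 1) (k n : ℕ) :
    Summable fun m : ℕ =>
      (-μ) ^ m * ((m + k).choose k * oneSubCoeff (-1 - β * (m + k : ℕ)) n) := by
  refine ((summable_resolvent hβ hβ1 hμ k n).congr fun m => ?_).of_norm
  have := (oneSubCoeff_pos (a := β * (m + k : ℕ)) (by positivity) n).le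
  rw [norm_mul, norm_pow, norm_neg, Real.norm_eq_abs, Real.norm_of_nonneg (by positivity)]

/-- Multiplication by `(1 - X)^β` acts termwise in the expansion in `μ`, by the Vandermonde identity
`oneSubCoeff_add`. -/
lemma resolventCoeff_conv {β : ℝ} (hβ : 0 ≤ β) (hβ1 : β ≤ 1) {μ : ℝ} (hμ : |μ| < 1) (k n : ℕ) :
    ∑ p ∈ antidiagonal n, oneSubCoeff β p.1 * resolventCoeff β μ k p.2 =
      ∑' m : ℕ, (-μ) ^ m * ((m + k).choose k * oneSubCoeff (β - 1 - β * (m + k : ℕ)) n) := by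
  simp only [resolventCoeff, ← tsum_mul_left]
  have h := Summable.tsum_finsetSum (s := antidiagonal n)
    (fun p _ => (summable_resolvent' hβ hβ1 hμ k p.2).mul_left (oneSubCoeff β p.1))
  refine h.symm.trans (tsum_congr fun m => ?_)
  rw [show β - 1 - β * (m + k : ℕ) = β + (-1 - β * (m + k : ℕ)) by ring, oneSubCoeff_add,
    mul_sum, mul_sum]
  refine sum_congr rfl fun p _ => by ring

lemma summable_resolvent_conv {β : ℝ} (hβ : 0 ≤ β) (hβ1 : β ≤ 1) {μ : ℝ} (hμ : |μ| < 1)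
    (k n : ℕ) : Summable fun m : ℕ =>
      (-μ) ^ m * ((m + k).choose k * oneSubCoeff (β - 1 - β * (m + k : ℕ)) n) := by
  have h := summable_sum (s := antidiagonal n)
    (fun p _ => (summable_resolvent' hβ hβ1 hμ k p.2).mul_left (oneSubCoeff β p.1))
  refine h.congr fun m => ?_
  rw [show β - 1 - β * (m + k : ℕ) = β + (-1 - β * (m + k : ℕ)) by ring, oneSubCoeff_add,
    mul_sum, mul_sum]
  refine sum_congr rfl fun p _ => by ring

/-- With `G_k` the series of `resolventCoeff`, this is `((1 - X)^β + μ) G_0 = (1 - X)^(β-1)`: after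
the `m = 0` term is split off, the two sums cancel. -/
lemma resolventCoeff_zero_rec {β : ℝ} (hβ : 0 ≤ β) (hβ1 : β ≤ 1) {μ : ℝ} (hμ : |μ| < 1) (n : ℕ) :
    ∑ p ∈ antidiagonal n, oneSubCoeff β p.1 * resolventCoeff β μ 0 p.2 +
      μ * resolventCoeff β μ 0 n = oneSubCoeff (β - 1) n := by
  rw [resolventCoeff_conv hβ hβ1 hμ, (summable_resolvent_conv hβ hβ1 hμ 0 n).tsum_eq_zero_add,
    resolventCoeff, ← tsum_mul_left, add_assoc, ← Summable.tsum_add]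
  · simp only [add_zero, Nat.choose_zero_right, pow_zero]
    convert add_zero _
    · convert tsum_zero with m
      rw [show β - 1 - β * (m + 1 : ℕ) = -1 - β * m by push_cast; ring]
      ring
    · simp
  · exact (summable_nat_add_iff 1).2 (summable_resolvent_conv hβ hβ1 hμ 0 n)
  · exact (summable_resolvent' hβ hβ1 hμ 0 n).mul_left μ

/-- The identity `((1 - X)^β + μ) G_{k+1} = G_k`; Pascal's rule combines the two sums. -/
lemma resolventCoeff_succ_rec {β : ℝ} (hβ : 0 ≤ β) (hβ1 : β ≤ 1) {μ : ℝ} (hμ : |μ| < 1)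
    (k n : ℕ) :
    ∑ p ∈ antidiagonal n, oneSubCoeff β p.1 * resolventCoeff β μ (k + 1) p.2 +
      μ * resolventCoeff β μ (k + 1) n = resolventCoeff β μ k n := by
  rw [resolventCoeff_conv hβ hβ1 hμ,
    (summable_resolvent_conv hβ hβ1 hμ (k + 1) n).tsum_eq_zero_add, resolventCoeff,
    ← tsum_mul_left, add_assoc, ← Summable.tsum_add, resolventCoeff,
    (summable_resolvent' hβ hβ1 hμ k n).tsum_eq_zero_add]
  · congr 1
    · simp only [pow_zero, zero_add, Nat.choose_self]
      rw [show β - 1 - β * (k + 1 : ℕ) = -1 - β * k by push_cast; ring]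
    · refine tsum_congr fun m => ?_
      rw [show β - 1 - β * (m + 1 + (k + 1) : ℕ) = -1 - β * (m + 1 + k : ℕ) by push_cast; ring,
        show m + (k + 1) = m + 1 + k by ring, show m + 1 + (k + 1) = m + 1 + k + 1 by ring,
        Nat.choose_succ_succ]
      push_cast
      ring
  · exact (summable_nat_add_iff 1).2 (summable_resolvent_conv hβ hβ1 hμ (k + 1) n)
  · exact (summable_resolvent' hβ hβ1 hμ (k + 1) n).mul_left μ

/-- All coefficients of `(1 - X)^β` after the constant term are nonpositive, so `(1 + μ) G n` is at
least a combination of earlier `G j` with nonnegative weights. -/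
lemma nonneg_of_conv_nonneg {β μ : ℝ} (hβ : 0 ≤ β) (hβ1 : β ≤ 1) (hμ : 0 ≤ μ) {G : ℕ → ℝ}
    (hG : ∀ n, 0 ≤ ∑ p ∈ antidiagonal n, oneSubCoeff β p.1 * G p.2 + μ * G n) (n : ℕ) :
    0 ≤ G n := by
  induction n using Nat.strong_induction_on with
  | _ n ih =>
    have h := hG n
    cases n with
    | zero =>
      simp only [Nat.antidiagonal_zero, sum_singleton, oneSubCoeff_zero] at h
      nlinarith
    | succ n =>
      rw [Nat.sum_antidiagonal_succ, oneSubCoeff_zero] at h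
      have h2 : ∑ p ∈ antidiagonal n, oneSubCoeff β (p.1 + 1) * G p.2 ≤ 0 :=
        sum_nonpos fun p hp => mul_nonpos_of_nonpos_of_nonneg (oneSubCoeff_nonpos hβ hβ1 _)
          (ih _ (by have := mem_antidiagonal.1 hp; omega))
      simp only at h
      nlinarith

lemma resolventCoeff_nonneg {β μ : ℝ} (hβ : 0 ≤ β) (hβ1 : β ≤ 1) (hμ : 0 ≤ μ) (hμ1 : μ < 1)
    (k n : ℕ) : 0 ≤ resolventCoeff β μ k n := by
  have hμ' : |μ| < 1 := by rwa [abs_of_nonneg hμ]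
  induction k generalizing n with
  | zero =>
    refine nonneg_of_conv_nonneg hβ hβ1 hμ (fun n => ?_) n
    rw [resolventCoeff_zero_rec hβ hβ1 hμ']
    exact oneSubCoeff_nonneg (by linarith) n
  | succ k ih =>
    refine nonneg_of_conv_nonneg hβ hβ1 hμ (fun n => ?_) n
    rw [resolventCoeff_succ_rec hβ hβ1 hμ']
    exact ih n

/-- The Taylor coefficient `E_β^{(k)}(-lam) / k!`. -/
def taylorCoeff (lam β : ℝ) (k : ℕ) : ℝ :=
  ∑' m : ℕ, (-lam) ^ m * ((m + k).choose k * (Real.Gamma (β * (m + k : ℕ) + 1))⁻¹)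

lemma exists_mul_rpow_lt_one {β : ℝ} (hβ : 0 < β) (lam : ℝ) :
    ∃ M : ℕ, 0 < M ∧ ∀ n ≥ M, lam * (n : ℝ) ^ (-β) < 1 := by
  have h : Tendsto (fun n : ℕ => lam * (n : ℝ) ^ (-β)) atTop (𝓝 (lam * 0)) :=
    ((tendsto_rpow_neg_atTop hβ).comp tendsto_natCast_atTop_atTop).const_mul lam
  rw [mul_zero] at h
  obtain ⟨M, hM⟩ := eventually_atTop.1 (h.eventually_lt_const one_pos)
  exact ⟨M + 1, M.succ_pos, fun n hn => hM n (by omega)⟩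

/-- The series dominating the limit in `taylorCoeff_nonneg`: up to the factor `M^(-βk)` it is the
resolvent series at `μ = lam M^(-β)`. -/
lemma summable_bound {lam β : ℝ} (hlam : 0 ≤ lam) (hβ : 0 ≤ β) (hβ1 : β ≤ 1) {M : ℕ} (hM : 0 < M)
    (hM1 : lam * (M : ℝ) ^ (-β) < 1) (k : ℕ) :
    Summable fun m : ℕ => lam ^ m * ((m + k).choose k *
      (oneSubCoeff (-1 - β * (m + k : ℕ)) M / (M : ℝ) ^ (β * (m + k : ℕ)))) := by
  have hM0 : (0 : ℝ) < M := Nat.cast_pos.2 hM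
  have hμ : |lam * (M : ℝ) ^ (-β)| < 1 := by rwa [abs_of_nonneg (by positivity)]
  refine ((summable_resolvent hβ hβ1 hμ k M).mul_left (((M : ℝ) ^ (-β)) ^ k)).congr fun m => ?_
  rw [abs_of_nonneg (by positivity), Real.rpow_mul hM0.le, Real.rpow_natCast, Real.rpow_neg hM0.le,
    pow_add, mul_pow, inv_pow, inv_pow]
  field_simp

/-- A decreasing sequence lies above its limit. This replaces Stirling's formula in proving
convergence of the Mittag-Leffler series. -/
lemma inv_Gamma_le {β : ℝ} (hβ : 0 ≤ β) {M : ℕ} (hM : 0 < M) (j : ℕ) :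
    (Real.Gamma (β * j + 1))⁻¹ ≤ oneSubCoeff (-1 - β * j) M / (M : ℝ) ^ (β * j) :=
  le_of_tendsto (tendsto_oneSubCoeff_div_rpow (by positivity)) <| by
    filter_upwards [eventually_ge_atTop M] with n hn
    exact oneSubCoeff_div_rpow_anti (by positivity) hM hn

lemma Gamma_mul_add_one_pos {β : ℝ} (hβ : 0 ≤ β) (j : ℕ) : 0 < Real.Gamma (β * j + 1) :=
  Real.Gamma_pos_of_pos (by positivity)

lemma summable_pow_div_Gamma {r β : ℝ} (hr : 0 ≤ r) (hβ : 0 < β) (hβ1 : β ≤ 1) :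
    Summable fun n : ℕ => (Real.Gamma (β * n + 1))⁻¹ * r ^ n := by
  obtain ⟨M, hM, hM1⟩ := exists_mul_rpow_lt_one hβ r
  refine Summable.of_nonneg_of_le (fun n => ?_) (fun n => ?_)
    (summable_bound hr hβ.le hβ1 hM (hM1 M le_rfl) 0)
  · have := Gamma_mul_add_one_pos hβ.le n
    positivity
  · have := inv_Gamma_le hβ.le hM n
    simp only [add_zero, Nat.choose_zero_right, Nat.cast_one, one_mul]
    rw [mul_comm]
    gcongr

lemma taylorCoeff_nonneg {lam β : ℝ} (hlam : 0 ≤ lam) (hβ : 0 < β) (hβ1 : β ≤ 1) (k : ℕ) :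
    0 ≤ taylorCoeff lam β k := by
  obtain ⟨M, hM, hM1⟩ := exists_mul_rpow_lt_one hβ lam
  have key : Tendsto (fun n : ℕ => ∑' m : ℕ, (-lam) ^ m * ((m + k).choose k *
      (oneSubCoeff (-1 - β * (m + k : ℕ)) n / (n : ℝ) ^ (β * (m + k : ℕ))))) atTop
      (𝓝 (taylorCoeff lam β k)) := by
    refine tendsto_tsum_of_dominated_convergence (summable_bound hlam hβ.le hβ1 hM (hM1 M le_rfl) k)
      (fun m => ((tendsto_oneSubCoeff_div_rpow (by positivity)).const_mul _).const_mul _) ?_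
    filter_upwards [eventually_ge_atTop M] with n hn m
    have h1 := (oneSubCoeff_pos (a := β * (m + k : ℕ)) (by positivity) n).le
    rw [norm_mul, norm_pow, norm_neg, Real.norm_of_nonneg hlam, Real.norm_of_nonneg (by positivity)]
    exact mul_le_mul_of_nonneg_left (mul_le_mul_of_nonneg_left
      (oneSubCoeff_div_rpow_anti (by positivity) hM hn) (by positivity)) (by positivity)
  -- Before the limit, the sum is `n^(-βk)` times a resolvent coefficient at `μ = lam n^(-β)`, which
  -- is nonnegative once `μ < 1`.
  refine ge_of_tendsto key ?_
  filter_upwards [eventually_ge_atTop M] with n hn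
  have hn0 : (0 : ℝ) < n := Nat.cast_pos.2 (hM.trans_le hn)
  have h := mul_nonneg (pow_nonneg (Real.rpow_nonneg hn0.le (-β)) k)
    (resolventCoeff_nonneg hβ.le hβ1 (μ := lam * (n : ℝ) ^ (-β)) (by positivity) (hM1 n hn) k n)
  rw [resolventCoeff, ← tsum_mul_left] at h
  refine h.trans_eq (tsum_congr fun m => ?_)
  rw [Real.rpow_mul hn0.le, Real.rpow_natCast, Real.rpow_neg hn0.le, pow_add,
    ← neg_mul, mul_pow, inv_pow, inv_pow]
  field_simp

/-! ### Power series: recentring and Taylor coefficients -/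

/-- Expand `(a + h)^n` and sum by powers of `h`; absolute convergence of the double series is the
convergence of `∑ |c n| (|h| + |a|)^n`. -/
lemma hasSum_recenter {c : ℕ → ℂ} (hc : ∀ r : ℝ, 0 ≤ r → Summable fun n => ‖c n‖ * r ^ n)
    (a h : ℂ) :
    HasSum (fun k => h ^ k * ∑' m, a ^ m * ((m + k).choose k * c (m + k)))
      (∑' n, c n * (a + h) ^ n) := by
  set F : ℕ × ℕ → ℂ := fun p => h ^ p.1 * (a ^ p.2 * ((p.2 + p.1).choose p.1 * c (p.2 + p.1)))
    with hF
  have hsum : Summable fun p => ‖F p‖ := by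
    rw [← (HasAntidiagonal.sigmaAntidiagonalEquivProd (A := ℕ)).summable_iff]
    refine (summable_sigma_of_nonneg fun x => norm_nonneg _).2 ⟨fun n => (hasSum_fintype _).summable, (hc (‖h‖ + ‖a‖) (by positivity)).congr fun n => ?_⟩
    rw [tsum_fintype]
    refine Eq.trans ?_ (sum_coe_sort (antidiagonal n) fun p => ‖F p‖).symm
    rw [(Commute.all _ _).add_pow', mul_sum]
    refine sum_congr rfl fun p hp => ?_
    rw [hF]
    simp only [norm_mul, norm_pow, nsmul_eq_mul, Complex.norm_natCast]
    rw [add_comm p.2, mem_antidiagonal.1 hp]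
    ring
  have hs := hsum.of_norm.hasSum
  have h1 := ((HasAntidiagonal.sigmaAntidiagonalEquivProd (A := ℕ)).hasSum_iff.2 hs).sigma (fun n => hasSum_fintype _)
  have h2 : HasSum (fun n => c n * (a + h) ^ n) (∑' p, F p) := by
    refine h1.congr_fun ?_
    intro n
    refine Eq.trans ?_ (sum_coe_sort (antidiagonal n) F).symm
    rw [add_comm a, (Commute.all _ _).add_pow', mul_sum]
    refine sum_congr rfl fun p hp => ?_
    rw [hF]
    simp only [nsmul_eq_mul]
    rw [add_comm p.2, mem_antidiagonal.1 hp]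
    ring
  rw [h2.tsum_eq]
  refine (hs.prod_fiberwise fun k => (hsum.of_norm.prod_factor k).hasSum).congr_fun ?_
  intro k
  exact tsum_mul_left.symm

lemma hasFPowerSeriesAt_of_hasSum {f : ℂ → ℂ} {c : ℕ → ℂ} {a : ℂ}
    (h : ∀ z, HasSum (fun n => z ^ n * c n) (f (a + z))) :
    HasFPowerSeriesAt f (.ofScalars ℂ c) a :=
  hasFPowerSeriesAt_iff.2 <| .of_forall fun z => by simpa using h z

lemma iteratedDeriv_eq_of_hasFPowerSeriesAt {f : ℂ → ℂ} {p : FormalMultilinearSeries ℂ ℂ ℂ} {a : ℂ}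
    (h : HasFPowerSeriesAt f p a) (n : ℕ) : iteratedDeriv n f a = n.factorial * p.coeff n := by
  obtain ⟨r, hr⟩ := h
  have := hr.factorial_smul 1 n
  rw [iteratedDeriv_eq_iteratedFDeriv]
  refine this.symm.trans ?_
  rw [nsmul_eq_mul]
  rfl

lemma iteratedDeriv_eq_of_hasSum {f : ℂ → ℂ} {c : ℕ → ℂ} {a : ℂ}
    (h : ∀ z, HasSum (fun n => z ^ n * c n) (f (a + z))) (n : ℕ) :
    iteratedDeriv n f a = n.factorial * c n := by
  rw [iteratedDeriv_eq_of_hasFPowerSeriesAt (hasFPowerSeriesAt_of_hasSum h) n,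
    FormalMultilinearSeries.coeff_ofScalars]

lemma iteratedDeriv_mul_div_factorial {f g : ℂ → ℂ} (hf : AnalyticAt ℂ f 0) (hg : AnalyticAt ℂ g 0)
    (n : ℕ) : iteratedDeriv n (f * g) 0 / n.factorial =
      ∑ p ∈ antidiagonal n, iteratedDeriv p.1 f 0 / p.1.factorial *
        (iteratedDeriv p.2 g 0 / p.2.factorial) := by
  rw [iteratedDeriv_mul hf.contDiffAt hg.contDiffAt,
    Nat.sum_antidiagonal_eq_sum_range_succ_mk, sum_div]
  refine sum_congr rfl fun i hi => ?_
  rw [Nat.cast_choose ℂ (by simpa [Nat.lt_succ_iff] using hi)]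
  have h1 : (n.factorial : ℂ) ≠ 0 := Nat.cast_ne_zero.2 n.factorial_ne_zero
  have h2 : (i.factorial : ℂ) ≠ 0 := Nat.cast_ne_zero.2 i.factorial_ne_zero
  have h3 : ((n - i).factorial : ℂ) ≠ 0 := Nat.cast_ne_zero.2 (n - i).factorial_ne_zero
  field_simp

/-! ### The Mittag-Leffler function and the masses of the fractional Poisson measure -/

section

variable {lam β : ℝ}

lemma summable_norm_inv_Gamma (hβ : 0 < β) (hβ1 : β ≤ 1) (r : ℝ) (hr : 0 ≤ r) :
    Summable fun n : ℕ => ‖(((Real.Gamma (β * n + 1))⁻¹ : ℝ) : ℂ)‖ * r ^ n :=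
  (summable_pow_div_Gamma hr hβ hβ1).congr fun n => by
    rw [Complex.norm_real, Real.norm_of_nonneg (inv_nonneg.2 (Gamma_mul_add_one_pos hβ.le n).le)]

lemma mittagLeffler_eq_tsum (β : ℝ) (z : ℂ) :
    mittagLeffler β z = ∑' n : ℕ, (((Real.Gamma (β * n + 1))⁻¹ : ℝ) : ℂ) * z ^ n :=
  tsum_congr fun n => by rw [div_eq_mul_inv, mul_comm, Complex.ofReal_inv]

lemma hasSum_mittagLeffler (hβ : 0 < β) (hβ1 : β ≤ 1) (z : ℂ) :
    HasSum (fun n : ℕ => (((Real.Gamma (β * n + 1))⁻¹ : ℝ) : ℂ) * z ^ n) (mittagLeffler β z) := by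
  rw [mittagLeffler_eq_tsum]
  refine (Summable.of_norm ?_).hasSum
  simpa only [norm_mul, norm_pow] using summable_norm_inv_Gamma hβ hβ1 ‖z‖ (norm_nonneg z)

lemma differentiable_mittagLeffler (hβ : 0 < β) (hβ1 : β ≤ 1) :
    Differentiable ℂ (mittagLeffler β) := fun a =>
  (hasFPowerSeriesAt_of_hasSum (a := a) fun h => by
    rw [mittagLeffler_eq_tsum]
    exact hasSum_recenter (summable_norm_inv_Gamma hβ hβ1) a h).differentiableAt

lemma mittagLeffler_zero (β : ℝ) : mittagLeffler β 0 = 1 := by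
  rw [mittagLeffler_eq_tsum, tsum_eq_single 0 fun n hn => by simp [hn]]
  simp

lemma hasSum_mittagLeffler_neg_add (hβ : 0 < β) (hβ1 : β ≤ 1) (lam : ℝ) (h : ℂ) :
    HasSum (fun k => h ^ k * (taylorCoeff lam β k : ℂ)) (mittagLeffler β (-lam + h)) := by
  rw [mittagLeffler_eq_tsum]
  convert hasSum_recenter (summable_norm_inv_Gamma hβ hβ1) (-lam) h using 3 with k
  rw [taylorCoeff, Complex.ofReal_tsum]
  push_cast
  rfl

lemma mass_eq (hβ : 0 < β) (hβ1 : β ≤ 1) (lam : ℝ) (k : ℕ) :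
    mass lam β k = lam ^ k * taylorCoeff lam β k := by
  rw [mass, iteratedDeriv_eq_of_hasSum (hasSum_mittagLeffler_neg_add hβ hβ1 lam) k,
    ← Complex.ofReal_natCast, ← Complex.ofReal_mul, Complex.ofReal_re]
  have : (k.factorial : ℝ) ≠ 0 := Nat.cast_ne_zero.2 k.factorial_ne_zero
  field_simp

lemma mass_nonneg (hlam : 0 ≤ lam) (hβ : 0 < β) (hβ1 : β ≤ 1) (k : ℕ) : 0 ≤ mass lam β k := by
  rw [mass_eq hβ hβ1]
  exact mul_nonneg (pow_nonneg hlam k) (taylorCoeff_nonneg hlam hβ hβ1 k)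

/-- The probability generating function: the Taylor expansion of `E_β` at `-lam` with increment `lam
w`. Being entire, it yields all exponential moments. -/
lemma hasSum_mass_mul_pow (hβ : 0 < β) (hβ1 : β ≤ 1) (lam : ℝ) (w : ℂ) :
    HasSum (fun k => (mass lam β k : ℂ) * w ^ k) (mittagLeffler β (lam * (w - 1))) := by
  convert hasSum_mittagLeffler_neg_add hβ hβ1 lam (lam * w) using 2 with k
  · rw [mass_eq hβ hβ1, mul_pow]
    push_cast
    ring
  · ring

lemma summable_mass_mul_pow (hβ : 0 < β) (hβ1 : β ≤ 1) (lam r : ℝ) :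
    Summable fun k => mass lam β k * r ^ k := by
  have := (hasSum_mass_mul_pow hβ hβ1 lam r).summable
  exact_mod_cast this

lemma summable_norm_mass (hlam : 0 ≤ lam) (hβ : 0 < β) (hβ1 : β ≤ 1) (r : ℝ) :
    Summable fun k => ‖(mass lam β k : ℂ)‖ * r ^ k :=
  (summable_mass_mul_pow hβ hβ1 lam r).congr fun k => by
    rw [Complex.norm_real, Real.norm_of_nonneg (mass_nonneg hlam hβ hβ1 k)]

lemma hasSum_mul_inv_Gamma (hβ : 0 < β) (hβ1 : β ≤ 1) (lam : ℝ) (z : ℂ) :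
    HasSum (fun n : ℕ => z ^ n * ((lam ^ n * (Real.Gamma (β * n + 1))⁻¹ : ℝ) : ℂ))
      (mittagLeffler β (lam * (0 + z))) := by
  convert hasSum_mittagLeffler hβ hβ1 (lam * z) using 2 with n
  · rw [mul_pow]
    push_cast
    ring
  · rw [zero_add]

/-- The factorial moments of the fractional Poisson measure. -/
lemma hasSum_mass_mul_choose (hlam : 0 ≤ lam) (hβ : 0 < β) (hβ1 : β ≤ 1) (n : ℕ) :
    HasSum (fun k : ℕ => (mass lam β k : ℂ) * (k.choose n : ℂ))
      ((lam ^ n * (Real.Gamma (β * n + 1))⁻¹ : ℝ) : ℂ) := by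
  have hs : Summable fun k : ℕ => (mass lam β k : ℂ) * (k.choose n : ℂ) := by
    refine .of_norm_bounded (summable_norm_mass hlam hβ hβ1 2) fun k => ?_
    rw [norm_mul, Complex.norm_natCast]
    gcongr
    exact_mod_cast k.choose_le_two_pow n
  -- Recentring the generating function at `w = 1` gives one expansion of `E_β(lam z)` at `0`; the
  -- Mittag-Leffler series gives another, and coefficients are compared.
  have h1 : ∀ z, HasSum (fun n => z ^ n * ∑' m, 1 ^ m * ((m + n).choose n * (mass lam β (m + n) : ℂ)))
      (mittagLeffler β (lam * (0 + z))) := fun z => by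
    convert hasSum_recenter (fun r _ => summable_norm_mass hlam hβ hβ1 r) 1 z using 1
    rw [(hasSum_mass_mul_pow hβ hβ1 lam (1 + z)).tsum_eq]
    congr 2
    ring
  have h2 := (iteratedDeriv_eq_of_hasSum (f := fun z => mittagLeffler β (lam * z)) h1 n).symm.trans
    (iteratedDeriv_eq_of_hasSum (f := fun z => mittagLeffler β (lam * z))
      (hasSum_mul_inv_Gamma hβ hβ1 lam) n)
  rw [← mul_left_cancel₀ (Nat.cast_ne_zero.2 n.factorial_ne_zero) h2]
  convert hs.hasSum using 1
  rw [← hs.sum_add_tsum_nat_add n, sum_eq_zero fun i hi => by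
    rw [Nat.choose_eq_zero_of_lt (mem_range.1 hi), Nat.cast_zero, mul_zero], zero_add]
  refine tsum_congr fun m => ?_
  rw [one_pow, one_mul, mul_comm]

/-! ### The generalized Appell polynomials -/

/-- The Taylor coefficients of `1 / E_β(lam z)` at `0`. -/
def recipCoeff (lam β : ℝ) (n : ℕ) : ℂ :=
  iteratedDeriv n (fun z : ℂ => (mittagLeffler β (lam * z))⁻¹) 0 / n.factorial

lemma analyticAt_mittagLeffler_mul (hβ : 0 < β) (hβ1 : β ≤ 1) (lam : ℝ) :
    AnalyticAt ℂ (fun z : ℂ => mittagLeffler β (lam * z)) 0 :=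
  ((differentiable_mittagLeffler hβ hβ1).comp (differentiable_id.const_mul (lam : ℂ))).analyticAt 0

lemma analyticAt_recip (hβ : 0 < β) (hβ1 : β ≤ 1) (lam : ℝ) :
    AnalyticAt ℂ (fun z : ℂ => (mittagLeffler β (lam * z))⁻¹) 0 :=
  (analyticAt_mittagLeffler_mul hβ hβ1 lam).fun_inv (by simp [mittagLeffler_zero])

lemma exists_recipCoeff_bound (hβ : 0 < β) (hβ1 : β ≤ 1) (lam : ℝ) :
    ∃ s K : ℝ, 0 < s ∧ s < 1 ∧ 0 < K ∧ ∀ n, ‖recipCoeff lam β n‖ * s ^ n ≤ K := by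
  obtain ⟨p, hp⟩ := analyticAt_recip hβ hβ1 lam
  obtain ⟨s, hs0, hs⟩ := ENNReal.lt_iff_exists_nnreal_btwn.1 (lt_min hp.radius_pos one_pos)
  obtain ⟨K, hK, h⟩ := p.norm_mul_pow_le_of_lt_radius (hs.trans_le (min_le_left _ _))
  refine ⟨s, K, by exact_mod_cast hs0, by exact_mod_cast hs.trans_le (min_le_right _ _), hK,
    fun n => le_trans ?_ (h n)⟩
  gcongr
  rw [recipCoeff, iteratedDeriv_eq_of_hasFPowerSeriesAt hp,
    mul_div_cancel_left₀ _ (Nat.cast_ne_zero.2 n.factorial_ne_zero)]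
  simp

lemma sum_recipCoeff (hβ : 0 < β) (hβ1 : β ≤ 1) (lam : ℝ) (n : ℕ) :
    ∑ p ∈ antidiagonal n, ((lam ^ p.1 * (Real.Gamma (β * p.1 + 1))⁻¹ : ℝ) : ℂ) *
      recipCoeff lam β p.2 = if n = 0 then 1 else 0 := by
  have h := iteratedDeriv_mul_div_factorial (analyticAt_mittagLeffler_mul hβ hβ1 lam)
    (analyticAt_recip hβ hβ1 lam) n
  have h1 : ((fun z : ℂ => mittagLeffler β (lam * z)) *
      fun z : ℂ => (mittagLeffler β (lam * z))⁻¹) =ᶠ[𝓝 0] fun _ => 1 := by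
    filter_upwards [(analyticAt_mittagLeffler_mul hβ hβ1 lam).continuousAt.eventually_ne
      (y := 0) (by simp [mittagLeffler_zero])] with z hz
    exact mul_inv_cancel₀ hz
  rw [h1.iteratedDeriv_eq, iteratedDeriv_const] at h
  refine Eq.trans (sum_congr rfl fun p _ => ?_) (h.symm.trans ?_)
  · rw [iteratedDeriv_eq_of_hasSum (f := fun z => mittagLeffler β (lam * z))
      (hasSum_mul_inv_Gamma hβ hβ1 lam),
      mul_div_cancel_left₀ _ (Nat.cast_ne_zero.2 (Nat.factorial_ne_zero _))]
    rfl
  · split_ifs with hn <;> simp [hn]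

lemma appell_eq_sum (hβ : 0 < β) (hβ1 : β ≤ 1) (lam : ℝ) (n : ℕ) (x : ℂ) :
    appell lam β n x = n.factorial *
      ∑ p ∈ antidiagonal n, Ring.choose x p.1 * recipCoeff lam β p.2 := by
  have hx := Complex.one_add_cpow_hasFPowerSeriesAt_zero (a := x)
  have h := iteratedDeriv_mul_div_factorial hx.analyticAt (analyticAt_recip hβ hβ1 lam) n
  have h1 : (fun z : ℂ => wickExp lam β (Complex.log (1 + z)) x) =ᶠ[𝓝 0]
      ((fun z : ℂ => (1 + z) ^ x) * fun z : ℂ => (mittagLeffler β (lam * z))⁻¹) := by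
    have : ContinuousAt (fun z : ℂ => 1 + z) 0 := by fun_prop
    filter_upwards [this.eventually_ne (y := 0) (by simp)] with z hz
    rw [wickExp, Complex.exp_log hz, Pi.mul_apply, Complex.cpow_def_of_ne_zero hz, div_eq_mul_inv,
      add_sub_cancel_left]
  rw [appell, h1.iteratedDeriv_eq, mul_comm (n.factorial : ℂ), ← div_eq_iff ?_, h]
  · refine sum_congr rfl fun p _ => ?_
    rw [iteratedDeriv_eq_of_hasFPowerSeriesAt hx,
      mul_div_cancel_left₀ _ (Nat.cast_ne_zero.2 (Nat.factorial_ne_zero _)), recipCoeff,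
      binomialSeries, FormalMultilinearSeries.coeff_ofScalars]
  · exact Nat.cast_ne_zero.2 (Nat.factorial_ne_zero _)

/-- Each factor obeys `|z - n| ≤ |z| + n`, so `(1 - X)^(-|z|)` majorizes `(1 + X)^z`
coefficientwise. -/
lemma norm_choose_le (z : ℂ) (n : ℕ) : ‖Ring.choose z n‖ ≤ oneSubCoeff (-‖z‖) n := by
  induction n with
  | zero => simp
  | succ n ih =>
    have h := congrArg norm (succ_mul_choose_succ z n)
    have h1 : ‖(n : ℂ) + 1‖ = n + 1 := by
      rw [← Nat.cast_succ, Complex.norm_natCast, Nat.cast_succ]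
    rw [norm_mul, norm_mul, h1] at h
    rw [oneSubCoeff_succ, mul_div_assoc', le_div_iff₀ (by positivity), mul_comm, h, mul_comm]
    refine mul_le_mul ih ((norm_sub_le _ _).trans_eq ?_) (norm_nonneg _)
      (oneSubCoeff_nonneg (by simp) n)
    rw [Complex.norm_natCast]
    ring

lemma hasSum_oneSubCoeff (a : ℝ) {s : ℝ} (hs : |s| < 1) :
    HasSum (fun n => oneSubCoeff a n * s ^ n) ((1 - s) ^ a) := by
  have h := (Real.one_add_rpow_hasFPowerSeriesOnBall_zero (a := a)).hasSum (y := -s)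
    (by simpa [enorm_eq_nnnorm] using! hs)
  simp only [binomialSeries_apply, List.ofFn_const, List.prod_replicate, smul_eq_mul,
    zero_add] at h
  rw [sub_eq_add_neg]
  refine h.congr_fun ?_
  intro n
  rw [neg_pow, oneSubCoeff]
  ring

lemma sum_norm_choose_le (z : ℂ) {s : ℝ} (hs : 0 ≤ s) (hs1 : s < 1) (t : Finset ℕ) :
    ∑ n ∈ t, ‖Ring.choose z n‖ * s ^ n ≤ (1 - s) ^ (-‖z‖) := by
  refine le_trans (sum_le_sum fun n _ => mul_le_mul_of_nonneg_right (norm_choose_le z n)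
    (pow_nonneg hs n)) (sum_le_hasSum t (fun n _ => ?_)
    (hasSum_oneSubCoeff _ (by rwa [abs_of_nonneg hs])))
  exact mul_nonneg (oneSubCoeff_nonneg (by simp) n) (pow_nonneg hs n)

lemma summable_norm_choose (z : ℂ) {s : ℝ} (hs : 0 ≤ s) (hs1 : s < 1) :
    Summable fun n => ‖Ring.choose z n‖ * s ^ n :=
  summable_of_sum_le (fun n => by positivity) (sum_norm_choose_le z hs hs1)

lemma exists_appell_bound (hβ : 0 < β) (hβ1 : β ≤ 1) (lam : ℝ) :
    ∃ s K : ℝ, 0 < s ∧ s < 1 ∧ 0 < K ∧ ∀ n z,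
      ‖appell lam β n z‖ ≤ K * (n.factorial * s⁻¹ ^ n) * (1 - s) ^ (-‖z‖) := by
  obtain ⟨s, K, hs, hs1, hK, h⟩ := exists_recipCoeff_bound hβ hβ1 lam
  refine ⟨s, K, hs, hs1, hK, fun n z => ?_⟩
  rw [appell_eq_sum hβ hβ1, norm_mul, Complex.norm_natCast]
  have h1 : ‖∑ p ∈ antidiagonal n, Ring.choose z p.1 * recipCoeff lam β p.2‖ ≤
      K * s⁻¹ ^ n * (1 - s) ^ (-‖z‖) := by
    refine (norm_sum_le _ _).trans ?_
    calc ∑ p ∈ antidiagonal n, ‖Ring.choose z p.1 * recipCoeff lam β p.2‖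
        ≤ ∑ p ∈ antidiagonal n, K * s⁻¹ ^ n * (‖Ring.choose z p.1‖ * s ^ p.1) := by
          refine sum_le_sum fun p hp => ?_
          have h2 : ‖recipCoeff lam β p.2‖ ≤ K * s⁻¹ ^ p.2 := by
            rw [inv_pow, ← div_eq_mul_inv, le_div_iff₀ (by positivity)]
            exact h _
          rw [norm_mul, ← mem_antidiagonal.1 hp, pow_add]
          calc _ ≤ ‖Ring.choose z p.1‖ * (K * s⁻¹ ^ p.2) := by gcongr
            _ = K * (s⁻¹ ^ p.1 * s⁻¹ ^ p.2) * (‖Ring.choose z p.1‖ * s ^ p.1) := by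
              rw [inv_pow, inv_pow]
              field_simp
      _ = K * s⁻¹ ^ n * ∑ k ∈ range (n + 1), ‖Ring.choose z k‖ * s ^ k := by
          rw [← mul_sum, Nat.sum_antidiagonal_eq_sum_range_succ_mk]
      _ ≤ _ := by
          gcongr
          exact sum_norm_choose_le z hs.le hs1 _
  calc _ ≤ n.factorial * (K * s⁻¹ ^ n * (1 - s) ^ (-‖z‖)) := by gcongr
    _ = _ := by ring

lemma differentiable_choose (n : ℕ) : Differentiable ℂ fun z : ℂ => Ring.choose z n := by
  induction n with
  | zero => simp
  | succ n ih =>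
    have h (z : ℂ) : Ring.choose z (n + 1) = (z - n) * Ring.choose z n / (n + 1) := by
      rw [← succ_mul_choose_succ, mul_div_cancel_left₀ _ (Nat.cast_add_one_ne_zero n)]
    simp only [h]
    fun_prop

lemma differentiable_appell (hβ : 0 < β) (hβ1 : β ≤ 1) (lam : ℝ) (n : ℕ) :
    Differentiable ℂ (appell lam β n) := by
  rw [show appell lam β n = _ from funext (appell_eq_sum hβ hβ1 lam n)]
  have := differentiable_choose
  fun_prop

/-- Integrating a shifted Appell polynomial against the fractional Poisson measure gives a
binomial coefficient. -/
lemma hasSum_mass_mul_appell (hlam : 0 ≤ lam) (hβ : 0 < β) (hβ1 : β ≤ 1) (n : ℕ) (z : ℂ) :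
    HasSum (fun k : ℕ => (mass lam β k : ℂ) * appell lam β n (k + z))
      (n.factorial * Ring.choose z n) := by
  have h1 (i : ℕ) : HasSum (fun k : ℕ => (mass lam β k : ℂ) * Ring.choose ((k : ℂ) + z) i)
      (∑ p ∈ antidiagonal i, Ring.choose z p.2 *
        ((lam ^ p.1 * (Real.Gamma (β * p.1 + 1))⁻¹ : ℝ) : ℂ)) := by
    refine (hasSum_sum fun p _ =>
      (hasSum_mass_mul_choose hlam hβ hβ1 p.1).mul_left (Ring.choose z p.2)).congr_fun ?_
    intro k
    rw [Ring.add_choose_eq i (Commute.all _ _), mul_sum]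
    refine sum_congr rfl fun p _ => ?_
    rw [Ring.choose_natCast]
    ring
  have h2 : HasSum (fun k : ℕ => (mass lam β k : ℂ) * appell lam β n (k + z))
      (n.factorial * ∑ p ∈ antidiagonal n, recipCoeff lam β p.2 *
        ∑ q ∈ antidiagonal p.1, Ring.choose z q.2 *
          ((lam ^ q.1 * (Real.Gamma (β * q.1 + 1))⁻¹ : ℝ) : ℂ)) := by
    refine ((hasSum_sum fun p _ =>
      (h1 p.1).mul_left (recipCoeff lam β p.2)).mul_left _).congr_fun ?_
    intro k
    rw [appell_eq_sum hβ hβ1, mul_left_comm, mul_sum]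
    congr 1
    refine sum_congr rfl fun p _ => by ring
  convert h2 using 2
  -- As formal series, `A` is `1 / E_β(lam X)`, `B` is `E_β(lam X)` and `C` is `(1 + X)^z`; the
  -- claim is `C = (B C) A`.
  let A : PowerSeries ℂ := .mk (recipCoeff lam β)
  let C : PowerSeries ℂ := .mk fun n => Ring.choose z n
  let B : PowerSeries ℂ := .mk fun n => ((lam ^ n * (Real.Gamma (β * n + 1))⁻¹ : ℝ) : ℂ)
  have hBA : B * A = 1 := by
    ext n
    rw [PowerSeries.coeff_mul, PowerSeries.coeff_one, ← sum_recipCoeff hβ hβ1 lam n]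
    simp [A, B]
  have hC : C = (B * C) * A := by
    rw [mul_right_comm, hBA, one_mul]
  have h3 := congrArg (PowerSeries.coeff n) hC
  rw [PowerSeries.coeff_mul, PowerSeries.coeff_mk] at h3
  rw [h3]
  refine sum_congr rfl fun p _ => ?_
  rw [PowerSeries.coeff_mul, mul_comm, PowerSeries.coeff_mk]
  congr 1
  refine sum_congr rfl fun q _ => ?_
  rw [PowerSeries.coeff_mk, PowerSeries.coeff_mk, mul_comm]

end

/-! ### Rapidly decreasing coefficient sequences -/

/-- All the norms `∑ (n!)² 2^{nq} |c_n|²` are finite. -/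
def IsRapid (c : ℕ → ℂ) : Prop :=
  ∀ q : ℕ, Summable fun n : ℕ => (n.factorial : ℝ) ^ 2 * 2 ^ (n * q) * ‖c n‖ ^ 2

lemma IsRapid.exists_bound {c : ℕ → ℂ} (hc : IsRapid c) (p : ℕ) :
    ∃ B : ℝ, ∀ n : ℕ, n.factorial * 2 ^ (n * p) * ‖c n‖ ≤ B := by
  refine ⟨√(∑' n : ℕ, (n.factorial : ℝ) ^ 2 * 2 ^ (n * (2 * p)) * ‖c n‖ ^ 2), fun n =>
    Real.le_sqrt_of_sq_le (le_trans (le_of_eq ?_)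
      ((hc (2 * p)).le_tsum n fun _ _ => by positivity))⟩
  ring

lemma IsRapid.summable {c : ℕ → ℂ} (hc : IsRapid c) {r : ℝ} (hr : 0 ≤ r) :
    Summable fun n : ℕ => ‖c n‖ * (n.factorial * r ^ n) := by
  obtain ⟨p, hp⟩ := pow_unbounded_of_one_lt (2 * r) one_lt_two
  obtain ⟨B, hB⟩ := hc.exists_bound p
  refine .of_nonneg_of_le (fun n => by positivity) (fun n => ?_)
    (summable_geometric_two.mul_left B)
  have h : r ^ n ≤ 2 ^ (n * p) * (1 / 2) ^ n := by
    rw [mul_comm n, pow_mul, ← mul_pow]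
    exact pow_le_pow_left₀ hr (by linarith) n
  calc ‖c n‖ * (n.factorial * r ^ n)
      ≤ ‖c n‖ * (n.factorial * (2 ^ (n * p) * (1 / 2) ^ n)) := by gcongr
    _ = n.factorial * 2 ^ (n * p) * ‖c n‖ * (1 / 2) ^ n := by ring
    _ ≤ _ := by gcongr; exact hB n

lemma differentiable_tsum_of_bound {F : ℕ → ℂ → ℂ} (hF : ∀ n, Differentiable ℂ (F n))
    (h : ∀ R : ℝ, ∃ u : ℕ → ℝ, Summable u ∧ ∀ n z, ‖z‖ < R → ‖F n z‖ ≤ u n) :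
    Differentiable ℂ fun z => ∑' n, F n z := fun z => by
  obtain ⟨u, hu, hb⟩ := h (‖z‖ + 1)
  have := Complex.differentiableOn_tsum_of_summable_norm hu
    (fun n => (hF n).differentiableOn) (Metric.isOpen_ball (x := (0 : ℂ)) (ε := ‖z‖ + 1))
    fun n w hw => hb n w (by simpa using hw)
  exact this.differentiableAt (Metric.isOpen_ball.mem_nhds (by simp))

lemma eval_descPochhammer_eq (n : ℕ) (z : ℂ) :
    (descPochhammer ℂ n).eval z = n.factorial * Ring.choose z n := by
  induction n with
  | zero => simp
  | succ n ih =>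
    rw [descPochhammer_succ_eval, ih, Nat.factorial_succ]
    push_cast
    linear_combination -(n.factorial : ℂ) * succ_mul_choose_succ z n

/-! ### Newton series -/

lemma IsRapid.newton_bound {c : ℕ → ℂ} (hc : IsRapid c) (R : ℝ) :
    ∃ u : ℕ → ℝ, Summable u ∧ ∀ n z, ‖z‖ < R → ‖c n * (descPochhammer ℂ n).eval z‖ ≤ u n := by
  refine ⟨_, (hc.summable zero_le_two).mul_right ((1 - 1 / 2) ^ (-R)), fun n z hz => ?_⟩
  have h := sum_norm_choose_le z (s := 1 / 2) (by norm_num) (by norm_num) {n}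
  rw [sum_singleton] at h
  rw [eval_descPochhammer_eq, norm_mul, norm_mul, Complex.norm_natCast]
  calc ‖c n‖ * (n.factorial * ‖Ring.choose z n‖)
      = ‖c n‖ * (n.factorial * 2 ^ n) * (‖Ring.choose z n‖ * (1 / 2) ^ n) := by
        rw [one_div, inv_pow]
        field_simp
    _ ≤ ‖c n‖ * (n.factorial * 2 ^ n) * (1 - 1 / 2) ^ (-R) := by
        gcongr
        exact h.trans (Real.rpow_le_rpow_of_exponent_ge (by norm_num) (by norm_num) (by linarith))

lemma differentiable_newton {c : ℕ → ℂ} (hc : IsRapid c) :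
    Differentiable ℂ fun z => ∑' n, c n * (descPochhammer ℂ n).eval z :=
  differentiable_tsum_of_bound (fun n => (descPochhammer ℂ n).differentiable.const_mul (c n))
    hc.newton_bound

lemma hasSum_newton {c : ℕ → ℂ} (hc : IsRapid c) (z : ℂ) :
    HasSum (fun n => c n * (descPochhammer ℂ n).eval z)
      (∑' n, c n * (descPochhammer ℂ n).eval z) := by
  obtain ⟨u, hu, h⟩ := hc.newton_bound (‖z‖ + 1)
  exact (Summable.of_norm_bounded hu fun n => h n z (by linarith)).hasSum

/-- For `0 < x ≤ 1/2` one has `-log(1 - x) ≤ (1 - x)⁻¹ - 1 ≤ 2x`. The exponent `l + 1` absorbs the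
factor `2`. -/
lemma one_sub_two_pow_rpow_le (l : ℕ) {R : ℝ} (hR : 0 ≤ R) :
    (1 - (1 / 2) ^ (l + 1) : ℝ) ^ (-R) ≤ Real.exp ((2 ^ l)⁻¹ * R) := by
  set x : ℝ := (1 / 2) ^ (l + 1) with hx
  have hx0 : 0 < x := by positivity
  have hx1 : x ≤ 1 / 2 := by
    rw [hx, pow_succ]
    exact mul_le_of_le_one_left (by norm_num) (pow_le_one₀ (by norm_num) (by norm_num))
  have h2 : ((2 : ℝ) ^ l)⁻¹ = 2 * x := by
    rw [hx, pow_succ, one_div, inv_pow]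
    ring
  rw [Real.rpow_def_of_pos (by linarith), h2]
  refine Real.exp_le_exp.2 ?_
  have h := Real.one_sub_inv_le_log_of_pos (x := 1 - x) (by linarith)
  have h3 : (1 - x)⁻¹ ≤ 1 + 2 * x := by
    rw [inv_le_iff_one_le_mul₀ (by linarith)]
    nlinarith
  nlinarith

lemma norm_newton_le {c : ℕ → ℂ} {l : ℕ} {B : ℝ}
    (hB : ∀ n : ℕ, n.factorial * 2 ^ (n * (l + 1)) * ‖c n‖ ≤ B) (z : ℂ) :
    ‖∑' n, c n * (descPochhammer ℂ n).eval z‖ ≤ B * Real.exp ((2 ^ l)⁻¹ * ‖z‖) := by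
  have hB0 : 0 ≤ B := (norm_nonneg (c 0)).trans (by simpa using hB 0)
  have hs0 : (0 : ℝ) ≤ (1 / 2) ^ (l + 1) := by positivity
  have hs1 : ((1 : ℝ) / 2) ^ (l + 1) < 1 := pow_lt_one₀ (by norm_num) (by norm_num) (by simp)
  have hs := summable_norm_choose z hs0 hs1
  refine (tsum_of_norm_bounded (hs.hasSum.mul_left B) fun n => ?_).trans ?_
  · rw [eval_descPochhammer_eq, norm_mul, norm_mul, Complex.norm_natCast]
    calc ‖c n‖ * (n.factorial * ‖Ring.choose z n‖)
        = n.factorial * 2 ^ (n * (l + 1)) * ‖c n‖ *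
            (‖Ring.choose z n‖ * ((1 / 2) ^ (l + 1)) ^ n) := by
          rw [← pow_mul, mul_comm (l + 1), one_div, inv_pow]
          field_simp
      _ ≤ _ := by gcongr; exact hB n
  · gcongr
    exact (hs.tsum_le_of_sum_le (sum_norm_choose_le z hs0 hs1)).trans
      (one_sub_two_pow_rpow_le l (norm_nonneg z))

/-- At `z = N` the terms with `n > N` vanish and `(N)_N = N! ≠ 0`, so the system is triangular. -/
lemma coeff_eq_zero_of_newton {e : ℕ → ℂ}
    (h : ∀ N : ℕ, ∑' n, e n * (descPochhammer ℂ n).eval (N : ℂ) = 0) (n : ℕ) : e n = 0 := by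
  induction n using Nat.strong_induction_on with
  | _ N ih =>
    have h1 := h N
    rw [tsum_eq_single N fun n hn => ?_] at h1
    · refine (mul_eq_zero.1 h1).resolve_right ?_
      rw [eval_descPochhammer_eq, Ring.choose_natCast, Nat.choose_self]
      simp [Nat.factorial_ne_zero]
    · rcases lt_or_gt_of_ne hn with hn | hn
      · rw [ih n hn, zero_mul]
      · rw [eval_descPochhammer_eq, Ring.choose_natCast, Nat.choose_eq_zero_of_lt hn]
        simp

/-! ### Appell series and their convolution with the fractional Poisson measure -/

variable {lam β : ℝ}

lemma IsRapid.appell_bound {c : ℕ → ℂ} (hc : IsRapid c) (hβ : 0 < β) (hβ1 : β ≤ 1) (lam : ℝ) :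
    ∃ (s : ℝ) (u : ℕ → ℝ), 0 < s ∧ s < 1 ∧ Summable u ∧ (∀ n, 0 ≤ u n) ∧
      ∀ n z, ‖c n * appell lam β n z‖ ≤ u n * (1 - s) ^ (-‖z‖) := by
  obtain ⟨s, K, hs, hs1, hK, h⟩ := exists_appell_bound hβ hβ1 lam
  refine ⟨s, _, hs, hs1, (hc.summable (inv_nonneg.2 hs.le)).mul_left K, fun n => by positivity,
    fun n z => ?_⟩
  rw [norm_mul]
  calc _ ≤ ‖c n‖ * (K * (n.factorial * s⁻¹ ^ n) * (1 - s) ^ (-‖z‖)) := by gcongr; exact h n z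
    _ = _ := by ring

lemma hasSum_appell {c : ℕ → ℂ} (hc : IsRapid c) (hβ : 0 < β) (hβ1 : β ≤ 1) (lam : ℝ) (z : ℂ) :
    HasSum (fun n => c n * appell lam β n z) (∑' n, c n * appell lam β n z) := by
  obtain ⟨s, u, -, -, hu, -, h⟩ := hc.appell_bound hβ hβ1 lam
  exact (Summable.of_norm_bounded (hu.mul_right _) fun n => h n z).hasSum

lemma differentiable_tsum_appell {c : ℕ → ℂ} (hc : IsRapid c) (hβ : 0 < β) (hβ1 : β ≤ 1)
    (lam : ℝ) : Differentiable ℂ fun z => ∑' n, c n * appell lam β n z := by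
  obtain ⟨s, u, hs, hs1, hu, hu0, h⟩ := hc.appell_bound hβ hβ1 lam
  refine differentiable_tsum_of_bound
    (fun n => (differentiable_appell hβ hβ1 lam n).const_mul (c n)) fun R =>
    ⟨_, hu.mul_right ((1 - s) ^ (-R)), fun n z hz => (h n z).trans ?_⟩
  exact mul_le_mul_of_nonneg_left (Real.rpow_le_rpow_of_exponent_ge (by linarith) (by linarith)
    (by linarith)) (hu0 n)

lemma summable_mass_mul_appell {c : ℕ → ℂ} (hc : IsRapid c) (hlam : 0 ≤ lam) (hβ : 0 < β)
    (hβ1 : β ≤ 1) (z : ℂ) : Summable fun p : ℕ × ℕ =>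
      (mass lam β p.1 : ℂ) * (c p.2 * appell lam β p.2 (p.1 + z)) := by
  obtain ⟨s, u, hs, hs1, hu, hu0, h⟩ := hc.appell_bound hβ hβ1 lam
  have hm := mass_nonneg hlam hβ hβ1
  have h1s : 0 < 1 - s := by linarith
  have hbound : ∀ k n : ℕ, ‖(mass lam β k : ℂ) * (c n * appell lam β n (k + z))‖ ≤
      mass lam β k * (1 - s)⁻¹ ^ k * (u n * (1 - s) ^ (-‖z‖)) := fun k n => by
    rw [norm_mul, Complex.norm_real, Real.norm_of_nonneg (hm k), mul_assoc]
    refine mul_le_mul_of_nonneg_left ((h n _).trans ?_) (hm k)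
    rw [mul_left_comm]
    refine mul_le_mul_of_nonneg_left ?_ (hu0 n)
    -- Since `|k + z| ≤ k + |z|`, the growth in `k` is `(1 - s)^(-k)`, controlled by an exponential
    -- moment of the masses.
    rw [← Real.rpow_natCast, Real.inv_rpow h1s.le, ← Real.rpow_neg h1s.le, ← Real.rpow_add h1s]
    refine Real.rpow_le_rpow_of_exponent_ge h1s (by linarith) ?_
    have := norm_add_le (k : ℂ) z
    rw [Complex.norm_natCast] at this
    linarith
  exact .of_norm_bounded ((summable_mass_mul_pow hβ hβ1 lam _).mul_of_nonneg (hu.mul_right _)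
      (fun k => mul_nonneg (hm k) (by positivity))
      (fun n => mul_nonneg (hu0 n) (by positivity))) fun p => hbound p.1 p.2

lemma integrable_and_integral_of_summable (hlam : 0 ≤ lam) (hβ : 0 < β) (hβ1 : β ≤ 1) {f : ℝ → ℂ}
    (hf : Summable fun k : ℕ => (mass lam β k : ℂ) * f k) :
    MeasureTheory.Integrable f (measure lam β) ∧
      ∫ x, f x ∂(measure lam β) = ∑' k : ℕ, (mass lam β k : ℂ) * f k := by
  have hm (k : ℕ) : (ENNReal.ofReal (mass lam β k)).toReal = mass lam β k :=
    ENNReal.toReal_ofReal (mass_nonneg hlam hβ hβ1 k)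
  have hs : Summable fun k : ℕ => (ENNReal.ofReal (mass lam β k)).toReal * ‖f k‖ :=
    hf.norm.congr fun k => by
      rw [hm, norm_mul, Complex.norm_real, Real.norm_of_nonneg (mass_nonneg hlam hβ hβ1 k)]
  refine ⟨MeasureTheory.integrable_sum_dirac (fun k => ENNReal.ofReal_ne_top) hs, ?_⟩
  rw [measure, MeasureTheory.integral_sum_dirac_eq_tsum (fun k => ENNReal.ofReal_ne_top) hs]
  exact tsum_congr fun k => by rw [hm, Complex.real_smul]

lemma integrable_and_integral_tsum_appell {c : ℕ → ℂ} (hc : IsRapid c) (hlam : 0 ≤ lam)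
    (hβ : 0 < β) (hβ1 : β ≤ 1) (z : ℂ) :
    MeasureTheory.Integrable (fun x : ℝ => ∑' n, c n * appell lam β n (x + z)) (measure lam β) ∧
      ∫ x : ℝ, ∑' n, c n * appell lam β n (x + z) ∂(measure lam β) =
        ∑' n, c n * (descPochhammer ℂ n).eval z := by
  have hsum := summable_mass_mul_appell hc hlam hβ hβ1 z
  have hf : Summable fun k : ℕ =>
      (mass lam β k : ℂ) * ∑' n, c n * appell lam β n (((k : ℝ) : ℂ) + z) :=
    hsum.prod.congr fun k => by rw [Complex.ofReal_natCast, ← tsum_mul_left]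
  obtain ⟨h1, h2⟩ := integrable_and_integral_of_summable hlam hβ hβ1
    (f := fun x : ℝ => ∑' n, c n * appell lam β n (x + z)) hf
  refine ⟨h1, h2.trans ?_⟩
  have hswap := Summable.tsum_comm (f := fun k n : ℕ =>
    (mass lam β k : ℂ) * (c n * appell lam β n (k + z))) hsum
  refine Eq.trans (tsum_congr fun k => ?_) (hswap.symm.trans (tsum_congr fun n => ?_))
  · rw [Complex.ofReal_natCast, ← tsum_mul_left]
  · rw [eval_descPochhammer_eq, ← (hasSum_mass_mul_appell hlam hβ hβ1 n z).tsum_eq,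
      ← tsum_mul_left]
    exact tsum_congr fun k => mul_left_comm _ _ _

/-! ### The test function space -/

lemma IsExpansion.tsum_eq {c : ℕ → ℂ} {φ : ℝ → ℂ} (h : IsExpansion lam β c φ) (x : ℝ) :
    ∑' n, c n * appell lam β n x = φ x := (h.2 x).tsum_eq

lemma IsExpansion.eq_zero (hlam : 0 ≤ lam) (hβ : 0 < β) (hβ1 : β ≤ 1) {e : ℕ → ℂ}
    (he : IsExpansion lam β e 0) : e = 0 := by
  refine funext (coeff_eq_zero_of_newton fun N => ?_)
  -- The shift `N` is real, so the integrand involves only values of the expansion on `ℝ`, where it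
  -- vanishes.
  rw [← (integrable_and_integral_tsum_appell he.1 hlam hβ hβ1 N).2]
  refine (MeasureTheory.integral_congr_ae (.of_forall fun x => ?_)).trans
    (MeasureTheory.integral_zero _ _)
  have := he.tsum_eq (x + N)
  push_cast at this
  exact this

lemma IsExpansion.unique (hlam : 0 ≤ lam) (hβ : 0 < β) (hβ1 : β ≤ 1) {c d : ℕ → ℂ} {φ : ℝ → ℂ}
    (hc : IsExpansion lam β c φ) (hd : IsExpansion lam β d φ) : c = d := by
  have h := hc.add (hd.smul (-1))
  have h0 : φ + (-1 : ℂ) • φ = 0 := by simp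
  rw [h0] at h
  have := h.eq_zero hlam hβ hβ1
  rwa [neg_one_smul, ← sub_eq_add_neg, sub_eq_zero] at this

namespace TestSpace

lemma coeff_eq (hlam : 0 ≤ lam) (hβ : 0 < β) (hβ1 : β ≤ 1) (φ : TestSpace lam β) {c : ℕ → ℂ}
    (hc : IsExpansion lam β c φ.toFun) : φ.coeff = c :=
  φ.isExpansion_coeff.unique hlam hβ hβ1 hc

/-- The coefficients are an arbitrary choice by definition, so their linearity rests on uniqueness.
-/
lemma coeff_add (hlam : 0 ≤ lam) (hβ : 0 < β) (hβ1 : β ≤ 1) (φ ψ : TestSpace lam β) :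
    (φ + ψ).coeff = φ.coeff + ψ.coeff :=
  coeff_eq hlam hβ hβ1 _ (φ.isExpansion_coeff.add ψ.isExpansion_coeff)

lemma coeff_smul (hlam : 0 ≤ lam) (hβ : 0 < β) (hβ1 : β ≤ 1) (a : ℂ) (φ : TestSpace lam β) :
    (a • φ).coeff = a • φ.coeff :=
  coeff_eq hlam hβ hβ1 _ (φ.isExpansion_coeff.smul a)

lemma isRapid_coeff (φ : TestSpace lam β) : IsRapid φ.coeff := φ.isExpansion_coeff.1

/-- The test function with a given rapidly decreasing sequence of coefficients. -/
def ofCoeff (hβ : 0 < β) (hβ1 : β ≤ 1) (lam : ℝ) (c : ℕ → ℂ) (hc : IsRapid c) : TestSpace lam β :=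
  ⟨fun x => ∑' n, c n * appell lam β n x, c, hc, fun x => hasSum_appell hc hβ hβ1 lam x⟩

lemma coeff_ofCoeff (hlam : 0 ≤ lam) (hβ : 0 < β) (hβ1 : β ≤ 1) (c : ℕ → ℂ) (hc : IsRapid c) :
    (ofCoeff hβ hβ1 lam c hc).coeff = c :=
  coeff_eq hlam hβ hβ1 _ ⟨hc, fun x => hasSum_appell hc hβ hβ1 lam x⟩

lemma sqrt_weight_two_mul (n p : ℕ) :
    √((n.factorial : ℝ) ^ 2 * 2 ^ (n * (2 * p))) = n.factorial * 2 ^ (n * p) := by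
  rw [Real.sqrt_eq_iff_mul_self_eq (by positivity) (by positivity)]
  ring

lemma norm_coeff_le (p : ℕ) (φ : TestSpace lam β) (n : ℕ) :
    n.factorial * 2 ^ (n * p) * ‖φ.coeff n‖ ≤ ‖toL2 (2 * p) φ‖ := by
  have h := lp.norm_apply_le_norm two_ne_zero (toL2 (2 * p) φ) n
  refine le_trans (le_of_eq ?_) h
  simp only [toL2]
  rw [norm_mul, Complex.norm_real, Real.norm_of_nonneg (Real.sqrt_nonneg _), sqrt_weight_two_mul]

/-- `toL2 q` as a linear map. -/
def toL2Linear (hlam : 0 ≤ lam) (hβ : 0 < β) (hβ1 : β ≤ 1) (q : ℕ) :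
    TestSpace lam β →ₗ[ℂ] lp (fun _ : ℕ => ℂ) 2 where
  toFun := toL2 q
  map_add' φ ψ := by
    ext n
    simp only [toL2, coeff_add hlam hβ hβ1, Pi.add_apply, mul_add]
    rfl
  map_smul' a φ := by
    ext n
    simp only [toL2, coeff_smul hlam hβ hβ1, Pi.smul_apply, smul_eq_mul, mul_left_comm _ a]
    rfl

end TestSpace

/-! ### Monomials in terms of falling factorials -/

lemma sum_stirlingSecond_mul_descPochhammer (m : ℕ) (z : ℂ) :
    ∑ n ∈ range (m + 1), (m.stirlingSecond n : ℂ) * (descPochhammer ℂ n).eval z = z ^ m := by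
  induction m with
  | zero => simp
  | succ m ih =>
    have h1 : ∑ n ∈ range (m + 1), ((n + 1 : ℕ) : ℂ) * m.stirlingSecond (n + 1) *
        (descPochhammer ℂ (n + 1)).eval z =
        ∑ n ∈ range (m + 1), (n : ℂ) * m.stirlingSecond n * (descPochhammer ℂ n).eval z := by
      have h2 := sum_range_succ' (fun n : ℕ =>
        (n : ℂ) * m.stirlingSecond n * (descPochhammer ℂ n).eval z) (m + 1)
      rw [sum_range_succ, Nat.stirlingSecond_eq_zero_of_lt m.lt_succ_self] at h2
      simpa using h2.symm
    rw [sum_range_succ', Nat.stirlingSecond_succ_zero, Nat.cast_zero, zero_mul, add_zero, pow_succ,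
      ← ih, sum_mul]
    calc _ = ∑ n ∈ range (m + 1), (((n + 1 : ℕ) : ℂ) * m.stirlingSecond (n + 1) *
          (descPochhammer ℂ (n + 1)).eval z +
          m.stirlingSecond n * (descPochhammer ℂ (n + 1)).eval z) :=
          sum_congr rfl fun n _ => by
            rw [Nat.stirlingSecond_succ_succ]
            push_cast
            ring
      _ = _ := by
          rw [sum_add_distrib, h1, ← sum_add_distrib]
          refine sum_congr rfl fun n _ => ?_
          rw [descPochhammer_succ_eval]
          ring

/-- The recurrence `S(m+1, n+1) = (n+1) S(m, n+1) + S(m, n)` is compared with Pascal's rule. -/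
lemma stirlingSecond_add_le (n j : ℕ) :
    (n + j).stirlingSecond n ≤ (n + j).choose n * n ^ j := by
  induction n generalizing j with
  | zero => cases j <;> simp
  | succ n ih =>
    induction j with
    | zero => simp [Nat.stirlingSecond_self]
    | succ j ihj =>
      have h1 := ih (j + 1)
      have h2 : n ^ (j + 1) ≤ (n + 1) ^ (j + 1) := Nat.pow_le_pow_left n.le_succ _
      rw [show n + 1 + (j + 1) = n + (j + 1) + 1 by ring, Nat.stirlingSecond_succ_succ,
        Nat.choose_succ_succ]
      rw [show n + 1 + j = n + (j + 1) by ring] at ihj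
      calc _ ≤ (n + 1) * ((n + (j + 1)).choose (n + 1) * (n + 1) ^ j) +
            (n + (j + 1)).choose n * (n + 1) ^ (j + 1) :=
            add_le_add (Nat.mul_le_mul_left _ ihj) (h1.trans (Nat.mul_le_mul_left _ h2))
        _ = _ := by ring

/-- Put `m = n + j`: the factorials cancel against `S(n+j, n) ≤ binom(n+j, n) n^j`, leaving `N t^n ∑
(n t)^j / j! = N (t e^t)^n`. -/
lemma stirlingSecond_sum_bound {U : ℕ → ℂ} {N t : ℝ} (ht : 0 ≤ t)
    (hU : ∀ m : ℕ, m.factorial * ‖U m‖ ≤ N * t ^ m) (n : ℕ) :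
    (Summable fun m => ‖U m * (m.stirlingSecond n : ℂ)‖) ∧
      n.factorial * ∑' m, ‖U m * (m.stirlingSecond n : ℂ)‖ ≤ N * (t * Real.exp t) ^ n := by
  have hN : 0 ≤ N := by
    have := (norm_nonneg (U 0)).trans (by simpa using hU 0)
    exact this
  have hle (j : ℕ) : ‖U (n + j) * ((n + j).stirlingSecond n : ℂ)‖ ≤
      N * t ^ n / n.factorial * ((n * t) ^ j / j.factorial) := by
    have hf : (0 : ℝ) < (n + j).factorial := Nat.cast_pos.2 (Nat.factorial_pos _)
    have h1 : ‖U (n + j)‖ ≤ N * t ^ (n + j) / (n + j).factorial := by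
      rw [le_div_iff₀ hf, mul_comm]
      exact hU _
    have h2 : ((n + j).stirlingSecond n : ℝ) ≤ ((n + j).choose n : ℝ) * n ^ j := by
      exact_mod_cast stirlingSecond_add_le n j
    rw [norm_mul, Complex.norm_natCast]
    calc _ ≤ N * t ^ (n + j) / (n + j).factorial * (((n + j).choose n : ℝ) * n ^ j) := by gcongr
      _ = _ := by
        rw [Nat.cast_add_choose, pow_add, mul_pow]
        field_simp
  have hexp : HasSum (fun j : ℕ => N * t ^ n / n.factorial * ((n * t) ^ j / j.factorial))
      (N * t ^ n / n.factorial * Real.exp (n * t)) := by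
    rw [Real.exp_eq_exp_ℝ]
    exact (NormedSpace.expSeries_div_hasSum_exp (n * t : ℝ)).mul_left _
  have hs : Summable fun j => ‖U (n + j) * ((n + j).stirlingSecond n : ℂ)‖ :=
    .of_nonneg_of_le (fun _ => norm_nonneg _) hle hexp.summable
  have hs' : Summable fun m => ‖U m * (m.stirlingSecond n : ℂ)‖ :=
    (summable_nat_add_iff n).1 (hs.congr fun j => by rw [add_comm])
  refine ⟨hs', ?_⟩
  rw [← hs'.sum_add_tsum_nat_add n, sum_eq_zero fun m hm => by
    rw [Nat.stirlingSecond_eq_zero_of_lt (mem_range.1 hm), Nat.cast_zero, mul_zero, norm_zero],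
    zero_add]
  have h3 : ∑' j, ‖U (j + n) * ((j + n).stirlingSecond n : ℂ)‖ ≤
      N * t ^ n / n.factorial * Real.exp (n * t) := by
    simp only [add_comm _ n]
    exact hexp.tsum_eq ▸ hs.tsum_le_tsum hle hexp.summable
  calc _ ≤ n.factorial * (N * t ^ n / n.factorial * Real.exp (n * t)) := by gcongr
    _ = _ := by
      rw [mul_pow, ← Real.exp_nat_mul]
      field_simp

/-! ### Entire functions of minimal exponential type -/

namespace EMin

lemma differentiable (u : EMin) : Differentiable ℂ u.toFun := ((Submodule.mem_iInf _).1 u.2 0).1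

lemma norm_le (u : EMin) (l : ℕ) (z : ℂ) :
    ‖u.toFun z‖ ≤ expNorm l u * Real.exp ((2 ^ l)⁻¹ * ‖z‖) := by
  have h : ‖u.toFun z‖ * Real.exp (-((2 ^ l)⁻¹ * ‖z‖)) ≤ expNorm l u := le_ciSup (bddAbove l u) z
  rwa [Real.exp_neg, ← div_eq_mul_inv, div_le_iff₀ (Real.exp_pos _)] at h

lemma expNorm_le {u : EMin} {l : ℕ} {B : ℝ}
    (h : ∀ z, ‖u.toFun z‖ ≤ B * Real.exp ((2 ^ l)⁻¹ * ‖z‖)) : expNorm l u ≤ B :=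
  ciSup_le fun z => by
    rw [Real.exp_neg, ← div_eq_mul_inv, div_le_iff₀ (Real.exp_pos _)]
    exact h z

/-- The Taylor coefficients at `0`. -/
def taylor (u : EMin) (m : ℕ) : ℂ := (m.factorial : ℂ)⁻¹ * iteratedDeriv m u.toFun 0

lemma hasSum_taylor (u : EMin) (z : ℂ) : HasSum (fun m => u.taylor m * z ^ m) (u.toFun z) := by
  refine (Complex.hasSum_taylorSeries_of_entire u.differentiable 0 z).congr_fun fun m => ?_
  rw [taylor, sub_zero, smul_eq_mul, smul_eq_mul]
  ring

lemma norm_taylor_le (u : EMin) (l m : ℕ) :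
    m.factorial * ‖u.taylor m‖ ≤ expNorm l u * (3 * (2 ^ l)⁻¹) ^ m := by
  have hm : (0 : ℝ) < m.factorial := Nat.cast_pos.2 m.factorial_pos
  rw [taylor, norm_mul, norm_inv, Complex.norm_natCast, mul_inv_cancel_left₀ hm.ne']
  rcases m.eq_zero_or_pos with rfl | hm0
  · simpa using u.norm_le l 0
  have hm1 : (0 : ℝ) < m := Nat.cast_pos.2 hm0
  have hN : 0 ≤ expNorm l u := apply_nonneg _ _
  -- The radius `m 2^l` makes the exponential factor `e^m`; then `m! ≤ m^m` and `e < 3` give the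
  -- constant `3`. It is positive only for `m > 0`.
  have h := Complex.norm_iteratedDeriv_le_of_forall_mem_sphere_norm_le m
    (R := m * 2 ^ l) (c := 0) (by positivity) u.differentiable.diffContOnCl
    (C := expNorm l u * Real.exp m) fun z hz => by
      refine (u.norm_le l z).trans_eq ?_
      rw [mem_sphere_zero_iff_norm.1 hz]
      field_simp
  refine h.trans ?_
  have hf : (m.factorial : ℝ) ≤ (m : ℝ) ^ m := by exact_mod_cast m.factorial_le_pow
  have he : Real.exp m ≤ 3 ^ m := by
    rw [← Real.exp_one_pow]
    exact pow_le_pow_left₀ (Real.exp_pos _).le Real.exp_one_lt_three.le m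
  rw [div_le_iff₀ (by positivity)]
  calc _ ≤ (m : ℝ) ^ m * (expNorm l u * 3 ^ m) := by gcongr
    _ = _ := by
      rw [mul_pow, mul_pow, inv_pow]
      field_simp

/-- The coefficients of the Newton series. -/
def newtonCoeff (u : EMin) (n : ℕ) : ℂ := ∑' m, u.taylor m * (m.stirlingSecond n : ℂ)

/-- The shift `4` makes `t = (3/16) 2^(-p)`, so `t e^t ≤ 3t = (9/16) 2^(-p) ≤ 2^(-p)`. -/
lemma taylor_sum_bound (u : EMin) (p n : ℕ) :
    n.factorial * ∑' m, ‖u.taylor m * (m.stirlingSecond n : ℂ)‖ ≤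
      expNorm (p + 4) u * ((1 / 2) ^ p) ^ n := by
  have hN : 0 ≤ expNorm (p + 4) u := apply_nonneg _ _
  refine (stirlingSecond_sum_bound (by positivity) (u.norm_taylor_le (p + 4)) n).2.trans ?_
  have h1 : (1 / 2 : ℝ) ^ p ≤ 1 := pow_le_one₀ (by norm_num) (by norm_num)
  have h0 : (0 : ℝ) < (1 / 2) ^ p := by positivity
  have h2 : 3 * ((2 : ℝ) ^ (p + 4))⁻¹ = 3 / 16 * (1 / 2) ^ p := by
    rw [pow_add, one_div, inv_pow, mul_inv]
    ring
  rw [h2]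
  have h3 : Real.exp (3 / 16 * (1 / 2) ^ p) ≤ 3 :=
    (Real.exp_le_exp.2 (by linarith)).trans Real.exp_one_lt_three.le
  gcongr
  nlinarith

lemma norm_newtonCoeff_le (u : EMin) (p n : ℕ) :
    n.factorial * ‖u.newtonCoeff n‖ ≤ expNorm (p + 4) u * ((1 / 2) ^ p) ^ n := by
  refine le_trans ?_ (u.taylor_sum_bound p n)
  gcongr
  exact norm_tsum_le_tsum_norm
    (stirlingSecond_sum_bound (by positivity) (u.norm_taylor_le 0) n).1

lemma weighted_newtonCoeff_le (u : EMin) (q n : ℕ) :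
    (n.factorial : ℝ) ^ 2 * 2 ^ (n * q) * ‖u.newtonCoeff n‖ ^ 2 ≤
      expNorm (q + 5) u ^ 2 * (1 / 2) ^ n := by
  -- Taking `p = q + 1` beats the weight `2^(nq)` with a factor `2^(-n)` to spare, whence the index
  -- `q + 5 = (q + 1) + 4`.
  have h := pow_le_pow_left₀ (by positivity) (u.norm_newtonCoeff_le (q + 1) n) 2
  have h1 : (2 : ℝ) ^ (n * q) * (((1 / 2) ^ (q + 1)) ^ n) ^ 2 ≤ (1 / 2) ^ n := by
    have h2 : (2 : ℝ) ^ (n * q) * (((1 / 2) ^ (q + 1)) ^ n) ^ 2 =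
        (2 ^ q * ((1 / 2) ^ (q + 1)) ^ 2) ^ n := by
      rw [mul_pow, mul_comm n q, pow_mul,
        pow_right_comm ((1 / 2 : ℝ) ^ (q + 1))]
    rw [h2]
    refine pow_le_pow_left₀ (by positivity) ?_ n
    have h3 : (2 : ℝ) ^ q * (1 / 2) ^ q = 1 := by rw [← mul_pow]; norm_num
    have h4 : (1 / 2 : ℝ) ^ q ≤ 1 := pow_le_one₀ (by norm_num) (by norm_num)
    calc (2 : ℝ) ^ q * ((1 / 2) ^ (q + 1)) ^ 2
        = 2 ^ q * (1 / 2) ^ q * ((1 / 2) ^ q * (1 / 4)) := by ring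
      _ ≤ 1 / 2 := by rw [h3]; linarith
  calc (n.factorial : ℝ) ^ 2 * 2 ^ (n * q) * ‖u.newtonCoeff n‖ ^ 2
      = 2 ^ (n * q) * (n.factorial * ‖u.newtonCoeff n‖) ^ 2 := by ring
    _ ≤ 2 ^ (n * q) * (expNorm (q + 1 + 4) u * ((1 / 2) ^ (q + 1)) ^ n) ^ 2 := by gcongr
    _ = expNorm (q + 5) u ^ 2 * (2 ^ (n * q) * (((1 / 2) ^ (q + 1)) ^ n) ^ 2) := by ring
    _ ≤ _ := by gcongr

lemma isRapid_newtonCoeff (u : EMin) : IsRapid u.newtonCoeff := fun q =>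
  .of_nonneg_of_le (fun n => by positivity) (u.weighted_newtonCoeff_le q)
    (summable_geometric_two.mul_left _)

lemma tsum_newtonCoeff (u : EMin) (z : ℂ) :
    ∑' n, u.newtonCoeff n * (descPochhammer ℂ n).eval z = u.toFun z := by
  have hs (n : ℕ) := (stirlingSecond_sum_bound (by positivity) (u.norm_taylor_le 0) n).1
  have hsum : Summable fun p : ℕ × ℕ =>
      u.taylor p.2 * (p.2.stirlingSecond p.1 : ℂ) * (descPochhammer ℂ p.1).eval z := by
    refine Summable.of_norm ((summable_prod_of_nonneg fun p => norm_nonneg _).2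
      ⟨fun n => ?_, ?_⟩)
    · simp only [norm_mul _ (Polynomial.eval z _)]
      exact (hs n).mul_right _
    · refine .of_nonneg_of_le (fun n => tsum_nonneg fun _ => norm_nonneg _) (fun n => ?_)
        ((summable_norm_choose z (s := (1 / 2) ^ 1) (by norm_num) (by norm_num)).mul_left
          (expNorm (1 + 4) u))
      simp only [norm_mul _ (Polynomial.eval z _), tsum_mul_right]
      rw [eval_descPochhammer_eq, norm_mul, Complex.norm_natCast]
      calc _ = n.factorial * (∑' m, ‖u.taylor m * (m.stirlingSecond n : ℂ)‖) *
            ‖Ring.choose z n‖ := by ring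
        _ ≤ expNorm (1 + 4) u * ((1 / 2) ^ 1) ^ n * ‖Ring.choose z n‖ :=
          mul_le_mul_of_nonneg_right (u.taylor_sum_bound 1 n) (norm_nonneg _)
        _ = _ := by ring
  have hswap := Summable.tsum_comm (f := fun n m : ℕ =>
    u.taylor m * (m.stirlingSecond n : ℂ) * (descPochhammer ℂ n).eval z) hsum
  refine Eq.trans (tsum_congr fun n => ?_) (hswap.symm.trans ?_)
  · rw [newtonCoeff, ← tsum_mul_right]
  · rw [← (u.hasSum_taylor z).tsum_eq]
    refine tsum_congr fun m => ?_
    rw [← sum_stirlingSecond_mul_descPochhammer m z, mul_sum, tsum_eq_sum (s := range (m + 1))]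
    · exact sum_congr rfl fun n _ => mul_assoc _ _ _
    · intro n hn
      rw [Nat.stirlingSecond_eq_zero_of_lt (by simpa using hn)]
      simp

end EMin

/-! ### The convolution as a linear homeomorphism -/

namespace TestSpace

/-- The Newton series `∑ φ_n (z)_n` as an entire function of minimal exponential type. -/
def newton (φ : TestSpace lam β) : EMin :=
  ⟨fun z => ∑' n, φ.coeff n * (descPochhammer ℂ n).eval z, (Submodule.mem_iInf _).2 fun l =>
    ⟨differentiable_newton φ.isRapid_coeff, _, norm_newton_le (φ.norm_coeff_le (l + 1))⟩⟩

lemma toFun_newton (φ : TestSpace lam β) (z : ℂ) :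
    φ.newton.toFun z = ∑' n, φ.coeff n * (descPochhammer ℂ n).eval z := rfl

lemma expNorm_newton_le (φ : TestSpace lam β) (l : ℕ) :
    EMin.expNorm l φ.newton ≤ ‖toL2 (2 * (l + 1)) φ‖ :=
  EMin.expNorm_le (norm_newton_le (φ.norm_coeff_le (l + 1)))

/-- The convolution as a linear bijection. -/
def convEquiv (hlam : 0 ≤ lam) (hβ : 0 < β) (hβ1 : β ≤ 1) : TestSpace lam β ≃ₗ[ℂ] EMin where
  toFun := newton
  map_add' φ ψ := Subtype.ext <| funext fun z => by
    refine Eq.trans ?_ ((hasSum_newton φ.isRapid_coeff z).add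
      (hasSum_newton ψ.isRapid_coeff z)).tsum_eq
    refine tsum_congr fun n => ?_
    rw [coeff_add hlam hβ hβ1, Pi.add_apply, add_mul]
  map_smul' a φ := Subtype.ext <| funext fun z => by
    refine Eq.trans ?_ ((hasSum_newton φ.isRapid_coeff z).mul_left a).tsum_eq
    refine tsum_congr fun n => ?_
    rw [coeff_smul hlam hβ hβ1, Pi.smul_apply, smul_eq_mul, mul_assoc]
  invFun u := ofCoeff hβ hβ1 lam u.newtonCoeff u.isRapid_newtonCoeff
  left_inv φ := by
    -- Both sequences give the same Newton series, so their difference vanishes at every natural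
    -- number.
    have h : φ.newton.newtonCoeff = φ.coeff := by
      refine sub_eq_zero.1 (funext (coeff_eq_zero_of_newton fun N => ?_))
      have h1 := (hasSum_newton φ.newton.isRapid_newtonCoeff N).sub
        (hasSum_newton φ.isRapid_coeff N)
      rw [EMin.tsum_newtonCoeff, toFun_newton, sub_self] at h1
      refine Eq.trans (tsum_congr fun n => ?_) h1.tsum_eq
      rw [Pi.sub_apply, sub_mul]
    refine Subtype.ext (funext fun x => ?_)
    refine Eq.trans ?_ (φ.isExpansion_coeff.tsum_eq x)
    rw [← h]
    rfl
  right_inv u := Subtype.ext <| funext fun z => by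
    refine Eq.trans ?_ (u.tsum_newtonCoeff z)
    refine tsum_congr fun n => ?_
    rw [coeff_ofCoeff hlam]

lemma withSeminorms_expNorm : WithSeminorms EMin.expNorm := ⟨rfl⟩

lemma continuous_convEquiv (hlam : 0 ≤ lam) (hβ : 0 < β) (hβ1 : β ≤ 1) :
    Continuous (convEquiv hlam hβ hβ1) := by
  -- Continuity is checked at every point, turning the distance of `toL2` images into the norm of `φ
  -- - φ₀` by linearity.
  refine continuous_iff_continuousAt.2 fun φ₀ =>
    (withSeminorms_expNorm.tendsto_nhds _ _).2 fun l ε hε => ?_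
  have hc : Continuous (toL2 (lam := lam) (β := β) (2 * (l + 1))) :=
    continuous_iInf_dom continuous_induced_dom
  filter_upwards [hc.continuousAt.eventually (Metric.ball_mem_nhds (toL2 (2 * (l + 1)) φ₀) hε)]
    with φ hφ
  rw [← map_sub]
  refine (expNorm_newton_le (φ - φ₀) l).trans_lt ?_
  have := (toL2Linear hlam hβ hβ1 (2 * (l + 1))).map_sub φ φ₀
  rw [dist_eq_norm] at hφ
  exact (congrArg norm this).trans_lt hφ

lemma norm_toL2_symm_le (hlam : 0 ≤ lam) (hβ : 0 < β) (hβ1 : β ≤ 1) (q : ℕ) (u : EMin) :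
    ‖toL2 q ((convEquiv hlam hβ hβ1).symm u)‖ ≤ 2 * EMin.expNorm (q + 5) u := by
  have hN : 0 ≤ EMin.expNorm (q + 5) u := apply_nonneg _ _
  refine lp.norm_le_of_tsum_le (by norm_num) (by positivity) ?_
  have h2 : (2 : ENNReal).toReal = ((2 : ℕ) : ℝ) := by norm_num
  simp only [h2, Real.rpow_natCast]
  have hw (n : ℕ) : ‖toL2 q ((convEquiv hlam hβ hβ1).symm u) n‖ ^ 2 =
      (n.factorial : ℝ) ^ 2 * 2 ^ (n * q) * ‖u.newtonCoeff n‖ ^ 2 := by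
    have hc : ((convEquiv hlam hβ hβ1).symm u).coeff = u.newtonCoeff :=
      coeff_ofCoeff hlam hβ hβ1 _ u.isRapid_newtonCoeff
    simp only [toL2, hc]
    rw [norm_mul, mul_pow, Complex.norm_real, Real.norm_eq_abs, sq_abs,
      Real.sq_sqrt (by positivity)]
  simp only [hw]
  have hg := hasSum_geometric_two.mul_left (EMin.expNorm (q + 5) u ^ 2)
  calc _ ≤ EMin.expNorm (q + 5) u ^ 2 * 2 :=
        hg.tsum_eq ▸ (u.isRapid_newtonCoeff q).tsum_le_tsum (u.weighted_newtonCoeff_le q)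
          hg.summable
    _ ≤ _ := by nlinarith [sq_nonneg (EMin.expNorm (q + 5) u)]

lemma continuous_convEquiv_symm (hlam : 0 ≤ lam) (hβ : 0 < β) (hβ1 : β ≤ 1) :
    Continuous (convEquiv hlam hβ hβ1).symm := by
  refine continuous_iInf_rng.2 fun q => continuous_induced_rng.2 ?_
  refine withSeminorms_expNorm.continuous_normedSpace_rng _
    ((toL2Linear hlam hβ hβ1 q).comp (convEquiv hlam hβ hβ1).symm.toLinearMap)
    ⟨{q + 5}, 2, fun u => ?_⟩
  rw [sup_singleton]
  exact norm_toL2_symm_le hlam hβ hβ1 q u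

end TestSpace

end FracPoisson

end

theorem mainTheorem1 (lam β : ℝ) (hlam : 0 < lam) (hβ : 0 < β) (hβ1 : β ≤ 1) :
    (∀ φ : FracPoisson.TestSpace lam β,
      (∃! c : ℕ → ℂ, FracPoisson.IsExpansion lam β c φ.toFun) ∧
      Differentiable ℂ φ.extend ∧ ∀ x : ℝ, φ.extend x = φ.toFun x) ∧
    ∃ T : FracPoisson.TestSpace lam β ≃L[ℂ] FracPoisson.EMin,
      ∀ (φ : FracPoisson.TestSpace lam β) (z : ℂ),
        MeasureTheory.Integrable (fun x : ℝ => φ.extend (x + z)) (FracPoisson.measure lam β) ∧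
        (T φ).toFun z = φ.conv z ∧
        HasSum (fun n : ℕ => φ.coeff n * (descPochhammer ℂ n).eval z) ((T φ).toFun z) := by
  refine ⟨fun φ => ⟨⟨φ.coeff, φ.isExpansion_coeff, fun c hc => (φ.coeff_eq hlam.le hβ hβ1 hc).symm⟩,
    FracPoisson.differentiable_tsum_appell φ.isRapid_coeff hβ hβ1 lam,
    φ.isExpansion_coeff.tsum_eq⟩,
    ⟨FracPoisson.TestSpace.convEquiv hlam.le hβ hβ1,
      FracPoisson.TestSpace.continuous_convEquiv hlam.le hβ hβ1,
      FracPoisson.TestSpace.continuous_convEquiv_symm hlam.le hβ hβ1⟩, fun φ z => ?_⟩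
  obtain ⟨h1, h2⟩ :=
    FracPoisson.integrable_and_integral_tsum_appell φ.isRapid_coeff hlam.le hβ hβ1 z
  exact ⟨h1, h2.symm, FracPoisson.hasSum_newton φ.isRapid_coeff z⟩
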